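/- **Setting.** Let $X^{(1)}=(X^{(1)}_1,\dots,X^{(1)}_K)$ be potentially missing variables, $O=(O_1,\dots,O_J)$ fully observed variables and $R=(R_1,\dots,R_K)\in\{0,1\}^K$ missingness indicators. The state spaces of the $X^{(1)}_k$ and $O_j$ are arbitrary measurable spaces with $\sigma$-finite reference measures, and $p(X^{(1)},O,R)$ (the full law) has a density with respect to their product and counting measure on $\{0,1\}^K$; statements about densities hold almost everywhere for this product measure. The proxies are $X_k=X_k^{(1)}$ if $R_k=1$ and $X_k=?$ if $R_k=0$; the observed law is the law of $(O,X,R)$. For a pattern $r\in\{0,1\}^K$ let $\mathbb M(r)=\{i: r_i=0\}$, $\mathbb O(r)=\{i:r_i=1\}$. **Positivity.** For some $\epsilon>0$: (P1) $p(R\mid X^{(1)},O)\ge\epsilon$ and (P2) $p(X^{(1)},O)\ge\epsilon$, for all values. **m-graphs.** An m-graph $\mathcal G$ is a graph on $X^{(1)}\cup O\cup R$ (the deterministic proxies, with their only edges $X_i^{(1)}\to X_i\leftarrow R_i$, are left out) of one of three kinds, each with its factorization and its Markov blanket $\mathrm{mb}_{\mathcal G}(v)$ (always without $v$ itself): * an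 m-DAG: directed acyclic, no edge from an $R_i$ to $X^{(1)}\cup O$; $p=\prod_v p(v\mid \mathrm{pa}(v))$; the blanket consists of parents, children and co-parents of children. * an m-ADMG: directed and bidirected edges, no directed cycle, no directed edge from an $R_i$ to $X^{(1)}\cup O$; the nested Markov (recursive) factorization; with $\mathrm{dis}(v)$ the bidirected-connected component of $v$ and $\mathrm{bd}(v)=\mathrm{pa}(v)\cup\mathrm{dis}(v)\cup\bigcup_{d\in \mathrm{dis}(v)}\mathrm{pa}(d)$, the blanket is $\mathrm{bd}(v)\cup\mathrm{ch}(v)\cup\bigcup_{c\in\mathrm{ch}(v)}\mathrm{bd}(c)$. * an m-CG: directed and undirected edges, no partially directed cycle; $p=\prod_\tau p(x_\tau\mid x_{\mathrm{pa}(\tau)})$ over the undirected components $\tau$, each factor being $Z_\tau(x_{\mathrm{pa}(\tau)})^{-1}\prod_A\phi_{\tau,A}(x_A)$ over the complete sets $A$ of the moral graph of $\tau\cup\mathrm{pa}(\tau)$; the blanket consists of parents, neighbours, children, and all $w$ with $w\to a$, $v\to b$ where $a,b$ are equal or joined by an undirected path. (S1) $R_i\notin\mathrm{mb}_{\mathcal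 G}(X_i^{(1)})$ for all $i$. **Pattern DAGs.** A pattern DAG for $\mathcal G$ is an acyclic multigraph $\mathcal H$ on a set of patterns with labelled edges $s\to^i r$, $s\neq r$, $i\in[K]$, such that for each edge $s\to^i r$ and each law $p$ that factorizes according to $\mathcal G$, $p(X_i^{(1)}\mid X_{-i}^{(1)},O,R=s)=p(X_i^{(1)}\mid X_{-i}^{(1)},O,R=r)$ wherever both are defined. It is PM-ID compatible if (I1) the complete case pattern $1=(1,\dots,1)$ is a vertex without incoming edges, and (I2) for each vertex $r$ and $i\in\mathbb M(r)$ there is a directed path from $1$ to $r$ whose last edge has label $i$. **PM-ID construction.** Start with all $2^K$ patterns and no edges. For each pattern $r$ and each $i\in\mathbb M(r)$: if $R_i\notin\mathrm{mb}_{\mathcal G}(X_i^{(1)})$, add the edge $\tilde r\to^i r$, where $\tilde r$ is $r$ with its $i$-th entry changed to $1$; otherwise return "fail". Return the graph. **Theorem (soundness of PM-ID).** Let $\mathcal G$ be an m-graph satisfying (S1). Then the PM-ID construction does not fail; it returns a graph $\mathcal H$ whose vertices are all the patterns, which is a pattern DAG for $\mathcal G$ and is PM-ID compatible. For every missing data model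 that satisfies (P1), (P2) and factorizes according to $\mathcal G$, the full law is identified from the observed law by processing the patterns along any topological ordering of $\mathcal H$ (such orderings exist, and each starts with the complete case pattern): * $p(X^{(1)},O,R=1)=p(X,O,R=1)$; * for each other pattern $r$, each $i\in\mathbb M(r)$ and each edge $s\to^i r$ of $\mathcal H$, $$p(X_i^{(1)}\mid X^{(1)}_{-i},O,R=r)=p(X_i^{(1)}\mid X^{(1)}_{-i},O,R=s);$$ the extrapolation density $p(X^{(1)}_{\mathbb M(r)}\mid X^{(1)}_{\mathbb O(r)},O,R=r)$ is the only conditional density with these $i$-th Gibbs factors ($i\in\mathbb M(r)$), which are known from the patterns processed before $r$, and its product with the observed density $p(X_{\mathbb O(r)},O,R=r)$ is $p(X^{(1)},O,R=r)$. Thus the steps up to any stage of the ordering determine, almost everywhere, the joint densities of the patterns processed so far. Consequently, on given state spaces with given reference measures, the full law is a function of the observed law within the class of all models that satisfy (P1), (P2) and factorize according to $\mathcal G$. -/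

import Mathlib

open MeasureTheory
open scoped ENNReal NNReal

universe u

namespace MissingData

/-! ### Factorizations of a density with respect to DAGs, ADMGs and chain graphs

Throughout, `V` is a finite vertex set, `S v` the state space of the variable at `v`, and `μ v` a
reference measure on `S v`. Densities are taken with respect to the product `Measure.pi μ`.
`lmarginal μ A f` integrates `f` over the coordinates in `A`. -/

section Graphical

variable {V : Type} [Fintype V] [DecidableEq V] {S : V → Type u} [∀ v, MeasurableSpace (S v)]

/-- `f` is a probability density with respect to the product of the reference measures. -/
structure IsDensity (μ : ∀ v, Measure (S v)) (f : (∀ v, S v) → ℝ≥0∞) : Prop where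
  measurable : Measurable f
  lintegral_eq_one : ∫⁻ c, f c ∂(Measure.pi μ) = 1

/-- `q` is a conditional density `q(x_C | x_W)`: a function of the coordinates in `C ∪ W` which
integrates to one over the coordinates in `C`. -/
structure IsCondDensity (μ : ∀ v, Measure (S v)) (C : Finset V) (W : Set V)
    (q : (∀ v, S v) → ℝ≥0∞) : Prop where
  measurable : Measurable q
  dependsOn : DependsOn q ((C : Set V) ∪ W)
  lmarginal_eq_one : ∀ c, lmarginal μ C q c = 1

/-- Parents of a vertex. -/
def parents (dir : V → V → Prop) (v : V) : Set V := {w | dir w v}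

/-- Children of a vertex. -/
def children (dir : V → V → Prop) (v : V) : Set V := {w | dir v w}

/-- Parents of a set of vertices that are not in the set. -/
def outerParents (dir : V → V → Prop) (C : Finset V) : Set V :=
  {w | w ∉ C ∧ ∃ v ∈ C, dir w v}

/-- DAG factorization: `p(v) = ∏ p(v_i | pa(v_i))`. -/
def DAGFactorizes (dir : V → V → Prop) (μ : ∀ v, Measure (S v)) (f : (∀ v, S v) → ℝ≥0∞) : Prop :=
  ∃ k : V → (∀ v, S v) → ℝ≥0∞,
    (∀ v, IsCondDensity μ {v} (parents dir v) (k v)) ∧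
    f =ᵐ[Measure.pi μ] fun c => ∏ v, k v c

open Classical in
/-- The districts of the induced graph on `C`: its bidirected-connected components. -/
noncomputable def districtsIn (bi : V → V → Prop) (C : Finset V) : Finset (Finset V) :=
  C.image fun v => C.filter fun w =>
    Relation.ReflTransGen (fun a b => a ∈ C ∧ b ∈ C ∧ bi a b) v w

/-- `A` is an ancestral subset of `C`: it contains all parents in `C` of its elements. -/
def IsAncestralIn (dir : V → V → Prop) (C A : Finset V) : Prop :=
  A ⊆ C ∧ ∀ a ∈ A, ∀ b ∈ C, dir b a → b ∈ A

/-- Nested Markov (recursive) factorization of a kernel `q(x_C | x_{pa(C) \ C})` with respect to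
the conditional ADMG with random vertices `C`, fixed vertices `pa(C) \ C`, and edges the directed
edges into `C` and the bidirected edges within `C`:

* `q` is a product, over the districts `D`, of kernels `q_D(x_D | x_{pa(D) \ D})`, each of which
  factorizes recursively if there are at least two districts;
* for every ancestral proper subset `A` of `C`, the margin of `q` over `A` is a kernel
  `q_A(x_A | x_{pa(A) \ A})` that factorizes recursively. -/
inductive NestedMarkov (dir bi : V → V → Prop) (μ : ∀ v, Measure (S v)) :
    Finset V → ((∀ v, S v) → ℝ≥0∞) → Prop
  | intro (C : Finset V) (q : (∀ v, S v) → ℝ≥0∞)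
      (kernel : IsCondDensity μ C (outerParents dir C) q)
      (qD : Finset V → (∀ v, S v) → ℝ≥0∞)
      (districtKernel : ∀ D ∈ districtsIn bi C, IsCondDensity μ D (outerParents dir D) (qD D))
      (districtFactorization :
        q =ᵐ[Measure.pi μ] fun c => ∏ D ∈ districtsIn bi C, qD D c)
      (districtRec : 2 ≤ (districtsIn bi C).card →
        ∀ D ∈ districtsIn bi C, NestedMarkov dir bi μ D (qD D))
      (qA : Finset V → (∀ v, S v) → ℝ≥0∞)
      (ancestralMargin : ∀ A, IsAncestralIn dir C A → A ≠ C →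
        lmarginal μ (C \ A) q =ᵐ[Measure.pi μ] qA A)
      (ancestralRec : ∀ A, IsAncestralIn dir C A → A ≠ C → NestedMarkov dir bi μ A (qA A)) :
      NestedMarkov dir bi μ C q

open Classical in
/-- The chain components: connected components of the undirected part of a chain graph. -/
noncomputable def chainComponents (und : V → V → Prop) : Finset (Finset V) :=
  Finset.univ.image fun v => Finset.univ.filter fun w => Relation.ReflTransGen und v w

open Classical in
/-- The complete subsets of the moral graph of `τ ∪ pa(τ)`: two distinct vertices are adjacent
there if they are both parents of `τ`, or are joined by an edge of the chain graph. -/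
noncomputable def moralCliques (dir und : V → V → Prop) (τ : Finset V) : Finset (Finset V) :=
  Finset.univ.filter fun A =>
    (∀ a ∈ A, a ∈ τ ∨ a ∈ outerParents dir τ) ∧
    ∀ a ∈ A, ∀ b ∈ A, a ≠ b →
      (a ∈ outerParents dir τ ∧ b ∈ outerParents dir τ) ∨ dir a b ∨ dir b a ∨ und a b

/-- The two-level chain graph factorization: `p(v) = ∏_τ p(x_τ | x_pa(τ))` over the chain
components `τ`, where `p(x_τ | x_pa(τ)) = Z_τ(x_pa(τ))⁻¹ ∏_A φ_{τ,A}(x_A)` over the complete sets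
`A` of the moral graph of `τ ∪ pa(τ)`, and `Z_τ` is the integral of the product over `x_τ`. -/
def CGFactorizes (dir und : V → V → Prop) (μ : ∀ v, Measure (S v))
    (f : (∀ v, S v) → ℝ≥0∞) : Prop :=
  ∃ φ : Finset V → Finset V → (∀ v, S v) → ℝ≥0,
    (∀ τ A, Measurable (φ τ A) ∧ DependsOn (φ τ A) (A : Set V)) ∧
    f =ᵐ[Measure.pi μ] fun c => ∏ τ ∈ chainComponents und,
      (∏ A ∈ moralCliques dir und τ, (φ τ A c : ℝ≥0∞)) /
        lmarginal μ τ (fun c' => ∏ A ∈ moralCliques dir und τ, (φ τ A c' : ℝ≥0∞)) c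

/-- Markov blanket in a DAG: parents, children and co-parents. -/
def dagBlanket (dir : V → V → Prop) (v : V) : Set V :=
  (parents dir v ∪ children dir v ∪ {w | ∃ c, dir w c ∧ dir v c}) \ {v}

/-- District of a vertex in an ADMG. -/
def district (bi : V → V → Prop) (v : V) : Set V := {w | Relation.ReflTransGen bi v w}

/-- Boundary of a vertex in an ADMG: parents, district, and parents of the district. -/
def boundary (dir bi : V → V → Prop) (v : V) : Set V :=
  parents dir v ∪ district bi v ∪ ⋃ d ∈ district bi v, parents dir d

/-- Markov blanket in an ADMG: boundary, children and boundaries of the children. -/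
def admgBlanket (dir bi : V → V → Prop) (v : V) : Set V :=
  (boundary dir bi v ∪ children dir v ∪ ⋃ c ∈ children dir v, boundary dir bi c) \ {v}

/-- Markov blanket in a chain graph: parents, neighbours, children and co-parents, the latter
being the `w` with `w → a`, `v → b` for some `a`, `b` joined by an undirected path
(possibly `a = b`). -/
def cgBlanket (dir und : V → V → Prop) (v : V) : Set V :=
  (parents dir v ∪ {w | und w v} ∪ children dir v ∪
    {w | ∃ a b, dir w a ∧ Relation.ReflTransGen und a b ∧ dir v b}) \ {v}

end Graphical

/-! ### Missing data graphs -/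

/-- The non-deterministic variables of a missing data model with `K` potentially missing and `J`
fully observed variables: `x k` stands for `X_k^(1)`, `o j` for `O_j`, `r k` for `R_k`.
The proxies `X_k` are deterministic functions of these and are left out of the graphs. -/
inductive Vtx (K J : ℕ) : Type
  | x (k : Fin K)
  | o (j : Fin J)
  | r (k : Fin K)
  deriving DecidableEq, Fintype

/-- m-DAG: no directed cycle, and edges out of an indicator only go to indicators. -/
structure MDAG (K J : ℕ) where
  dir : Vtx K J → Vtx K J → Prop
  acyclic : ∀ v, ¬ Relation.TransGen dir v v
  indicator_out : ∀ k v, dir (.r k) v → ∃ l, v = .r l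

/-- m-ADMG: directed and bidirected edges, no directed cycle, and directed edges out of an
indicator only go to indicators. -/
structure MADMG (K J : ℕ) where
  dir : Vtx K J → Vtx K J → Prop
  bi : Vtx K J → Vtx K J → Prop
  acyclic : ∀ v, ¬ Relation.TransGen dir v v
  indicator_out : ∀ k v, dir (.r k) v → ∃ l, v = .r l
  bi_symm : ∀ v w, bi v w → bi w v
  bi_irrefl : ∀ v, ¬ bi v v

/-- m-CG: directed and undirected edges, no partially directed cycle. -/
structure MCG (K J : ℕ) where
  dir : Vtx K J → Vtx K J → Prop
  und : Vtx K J → Vtx K J → Prop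
  und_symm : ∀ v w, und v w → und w v
  und_irrefl : ∀ v, ¬ und v v
  acyclic : ∀ v w, dir v w → ¬ Relation.ReflTransGen (fun a b => dir a b ∨ und a b) w v

/-- An m-graph is an m-DAG, an m-ADMG or an m-CG. -/
inductive MGraph (K J : ℕ) : Type
  | dag (G : MDAG K J)
  | admg (G : MADMG K J)
  | cg (G : MCG K J)

/-- The Markov blanket of a vertex in an m-graph. -/
def MGraph.blanket {K J : ℕ} : MGraph K J → Vtx K J → Set (Vtx K J)
  | .dag G => dagBlanket G.dir
  | .admg G => admgBlanket G.dir G.bi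
  | .cg G => cgBlanket G.dir G.und

/-- (S1): no indicator lies in the Markov blanket of the variable it indicates. -/
def MGraph.S1 {K J : ℕ} (G : MGraph K J) : Prop :=
  ∀ i : Fin K, Vtx.r i ∉ G.blanket (.x i)

/-! ### Missing data models -/

/-- State spaces of the potentially missing and of the fully observed variables, with
sigma-finite reference measures for the densities. -/
structure StateSpaces (K J : ℕ) where
  X : Fin K → Type u
  O : Fin J → Type u
  mX : ∀ k, MeasurableSpace (X k)
  mO : ∀ j, MeasurableSpace (O j)
  μX : ∀ k, Measure (X k)
  μO : ∀ j, Measure (O j)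
  sigmaFiniteX : ∀ k, SigmaFinite (μX k)
  sigmaFiniteO : ∀ j, SigmaFinite (μO j)

section Models

variable {K J : ℕ}

/-- State space of a variable of the full law; indicators are binary. -/
def StateSpaces.St (𝒮 : StateSpaces.{u} K J) : Vtx K J → Type u
  | .x k => 𝒮.X k
  | .o j => 𝒮.O j
  | .r _ => ULift.{u} Bool

instance (𝒮 : StateSpaces.{u} K J) (v : Vtx K J) : MeasurableSpace (𝒮.St v) :=
  match v with
  | .x k => 𝒮.mX k
  | .o j => 𝒮.mO j
  | .r _ => inferInstanceAs (MeasurableSpace (ULift.{u} Bool))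

/-- The reference measures; counting measure for the indicators. -/
noncomputable def StateSpaces.μ (𝒮 : StateSpaces.{u} K J) : ∀ v, Measure (𝒮.St v)
  | .x k => 𝒮.μX k
  | .o j => 𝒮.μO j
  | .r k => (Measure.count : Measure (𝒮.St (.r k)))

/-- Values of `(X^(1), O, R)`. -/
abbrev StateSpaces.Full (𝒮 : StateSpaces.{u} K J) : Type u := ∀ v, 𝒮.St v

/-- The product reference measure on the values of `(X^(1), O, R)`. -/
noncomputable abbrev StateSpaces.ref (𝒮 : StateSpaces.{u} K J) : Measure 𝒮.Full :=
  Measure.pi 𝒮.μ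

/-- Factorization of a density of the full law according to an m-graph. -/
def MGraph.Factorizes (G : MGraph K J) (𝒮 : StateSpaces.{u} K J) (f : 𝒮.Full → ℝ≥0∞) : Prop :=
  match G with
  | .dag G => DAGFactorizes G.dir 𝒮.μ f
  | .admg G => NestedMarkov G.dir G.bi 𝒮.μ Finset.univ f
  | .cg G => CGFactorizes G.dir G.und 𝒮.μ f

/-- The missingness indicators as vertices. -/
def indicatorVertices (K J : ℕ) : Finset (Vtx K J) := Finset.univ.image Vtx.r

/-- The density `p(X^(1), O)` of the target law. -/
noncomputable def targetDensity (𝒮 : StateSpaces.{u} K J) (f : 𝒮.Full → ℝ≥0∞) :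
    𝒮.Full → ℝ≥0∞ :=
  lmarginal 𝒮.μ (indicatorVertices K J) f

/-- (P1), (P2): for some `ε > 0`, both `p(R | X^(1), O) ≥ ε` and `p(X^(1), O) ≥ ε`. -/
def Positivity (𝒮 : StateSpaces.{u} K J) (f : 𝒮.Full → ℝ≥0∞) : Prop :=
  ∃ ε : ℝ≥0, 0 < ε ∧
    (∀ᵐ c ∂𝒮.ref, (ε : ℝ≥0∞) ≤ f c / targetDensity 𝒮 f c) ∧
    (∀ᵐ c ∂𝒮.ref, (ε : ℝ≥0∞) ≤ targetDensity 𝒮 f c)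

/-- `f` is the density of the full law of a missing data model that satisfies (P1), (P2) and
factorizes according to `G`. -/
structure IsModel (G : MGraph K J) (𝒮 : StateSpaces.{u} K J) (f : 𝒮.Full → ℝ≥0∞) : Prop where
  isDensity : IsDensity 𝒮.μ f
  factorizes : G.Factorizes 𝒮 f
  positivity : Positivity 𝒮 f

/-- The full law `p(X^(1), O, R)`. -/
noncomputable def fullLaw (𝒮 : StateSpaces.{u} K J) (f : 𝒮.Full → ℝ≥0∞) : Measure 𝒮.Full :=
  𝒮.ref.withDensity f

/-- Values of the observed variables `(X, O, R)`: the state space of the proxy `X_k` is that of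
`X_k^(1)` augmented by one value, which stands for `?`. -/
def StateSpaces.ObsSt (𝒮 : StateSpaces.{u} K J) : Vtx K J → Type u
  | .x k => 𝒮.X k ⊕ PUnit.{u + 1}
  | .o j => 𝒮.O j
  | .r _ => ULift.{u} Bool

instance (𝒮 : StateSpaces.{u} K J) (v : Vtx K J) : MeasurableSpace (𝒮.ObsSt v) :=
  match v with
  | .x k => letI := 𝒮.mX k; inferInstanceAs (MeasurableSpace (𝒮.X k ⊕ PUnit.{u + 1}))
  | .o j => 𝒮.mO j
  | .r _ => inferInstanceAs (MeasurableSpace (ULift.{u} Bool))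

/-- Values of `(X, O, R)`. -/
abbrev StateSpaces.Obs (𝒮 : StateSpaces.{u} K J) : Type u := ∀ v, 𝒮.ObsSt v

/-- Consistency: `X_k = X_k^(1)` if `R_k = 1` and `X_k = ?` if `R_k = 0`. -/
def observe (𝒮 : StateSpaces.{u} K J) (c : 𝒮.Full) : 𝒮.Obs
  | .x k => if (c (.r k) : ULift.{u} Bool).down = true
      then (Sum.inl (c (.x k)) : 𝒮.X k ⊕ PUnit.{u + 1})
      else (Sum.inr PUnit.unit : 𝒮.X k ⊕ PUnit.{u + 1})
  | .o j => c (.o j)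
  | .r k => c (.r k)

/-- The observed law `p(O, X, R)`. -/
noncomputable def observedLaw (𝒮 : StateSpaces.{u} K J) (f : 𝒮.Full → ℝ≥0∞) : Measure 𝒮.Obs :=
  (fullLaw 𝒮 f).map (observe 𝒮)

theorem measurable_observe (𝒮 : StateSpaces.{u} K J) : Measurable (observe 𝒮) := by
  refine measurable_pi_iff.2 fun v => ?_
  cases v with
  | o j => exact measurable_pi_apply (Vtx.o j : Vtx K J)
  | r k => exact measurable_pi_apply (Vtx.r k : Vtx K J)
  | x k =>
    let _ := 𝒮.mX k
    have hr : Measurable fun c : 𝒮.Full => (c (.r k) : ULift.{u} Bool).down :=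
      measurable_down.comp (measurable_pi_apply (Vtx.r k : Vtx K J))
    exact Measurable.ite (hr (measurableSet_singleton true))
      (measurable_inl.comp (measurable_pi_apply (Vtx.x k : Vtx K J))) measurable_const

/-! ### Pattern DAGs -/

/-- A missingness pattern; `true` is the value `1` (observed). -/
abbrev Pattern (K : ℕ) : Type := Fin K → Bool

/-- The complete case pattern. -/
def complete (K : ℕ) : Pattern K := fun _ => true

/-- `M(r)`, the indices that are missing in the pattern `r`. -/
def missing (r : Pattern K) : Finset (Fin K) := Finset.univ.filter fun i => r i = false

/-- Replace the values of the indicators by the pattern `r`. -/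
def withPattern (𝒮 : StateSpaces.{u} K J) (r : Pattern K) (c : 𝒮.Full) : 𝒮.Full
  | .x k => c (.x k)
  | .o j => c (.o j)
  | .r k => (ULift.up (r k) : ULift.{u} Bool)

/-- The joint density `p(X^(1), O, R = r)`, as a function of the values of `X^(1), O`. -/
def jointAt (𝒮 : StateSpaces.{u} K J) (f : 𝒮.Full → ℝ≥0∞) (r : Pattern K) : 𝒮.Full → ℝ≥0∞ :=
  fun c => f (withPattern 𝒮 r c)

/-- The normalizing margin of the `i`-th Gibbs factor: `g` integrated over `x_i`. -/
noncomputable def gibbsDenom (𝒮 : StateSpaces.{u} K J) (i : Fin K) (g : 𝒮.Full → ℝ≥0∞) :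
    𝒮.Full → ℝ≥0∞ :=
  lmarginal 𝒮.μ {Vtx.x i} g

/-- The `i`-th Gibbs factor of a joint or conditional density `g`. For `g = p(X^(1), O, R = r)`
this is `p(X_i^(1) | X_{-i}^(1), O, R = r)`. -/
noncomputable def gibbs (𝒮 : StateSpaces.{u} K J) (i : Fin K) (g : 𝒮.Full → ℝ≥0∞) :
    𝒮.Full → ℝ≥0∞ :=
  fun c => g c / gibbsDenom 𝒮 i g c

/-- A labelled directed multigraph on patterns; `(a, i, b)` is the edge `a →^i b`. -/
structure PatternGraph (K : ℕ) where
  verts : Finset (Pattern K)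
  edges : Finset (Pattern K × Fin K × Pattern K)

/-- There is an edge from `a` to `b`, with some label. -/
def PatternGraph.Adj (H : PatternGraph K) (a b : Pattern K) : Prop := ∃ i, (a, i, b) ∈ H.edges

/-- `H` is a pattern DAG with respect to the m-graph `G`: an acyclic labelled multigraph on
patterns such that every edge `a →^i b` stands for the equality of the `i`-th Gibbs factors of the
patterns `a` and `b`, wherever these are defined, in every law that factorizes according
to `G`. -/
structure IsPatternDAG (G : MGraph K J) (H : PatternGraph K) : Prop where
  edge_mem : ∀ a i b, (a, i, b) ∈ H.edges → a ∈ H.verts ∧ b ∈ H.verts ∧ a ≠ b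
  acyclic : ∀ a, ¬ Relation.TransGen H.Adj a a
  gibbs_eq : ∀ a i b, (a, i, b) ∈ H.edges →
    ∀ (𝒮 : StateSpaces.{u} K J) (f : 𝒮.Full → ℝ≥0∞), IsDensity 𝒮.μ f → G.Factorizes 𝒮 f →
      ∀ᵐ c ∂𝒮.ref, gibbsDenom 𝒮 i (jointAt 𝒮 f a) c ≠ 0 →
        gibbsDenom 𝒮 i (jointAt 𝒮 f b) c ≠ 0 →
        gibbs 𝒮 i (jointAt 𝒮 f a) c = gibbs 𝒮 i (jointAt 𝒮 f b) c

/-- PM-ID compatibility. (I1): the complete case pattern is a root node. (I2): for every pattern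
`r` and every `i` missing in `r`, some directed path from the complete case pattern to `r` has a
last edge with label `i`. -/
structure PMIDCompatible (H : PatternGraph K) : Prop where
  root_mem : complete K ∈ H.verts
  root : ∀ a i, (a, i, complete K) ∉ H.edges
  path : ∀ r ∈ H.verts, ∀ i ∈ missing r,
    ∃ s, Relation.ReflTransGen H.Adj (complete K) s ∧ (s, i, r) ∈ H.edges

open Classical in
/-- The body of the inner loop of the construction, for the pattern `r` and the index `i`:
add `r' →^i r`, where `r'` is `r` with `i` observed, if `R_i ∉ mb(X_i^(1))`; otherwise fail. -/
noncomputable def constructionStep (G : MGraph K J) (r : Pattern K) (H : PatternGraph K)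
    (i : Fin K) : Option (PatternGraph K) :=
  if Vtx.r i ∉ G.blanket (.x i) then
    some { H with edges := insert (Function.update r i true, i, r) H.edges }
  else none

/-- The PM-ID construction: start from the graph with all patterns and no edge, loop over all
patterns `r` and all `i` missing in `r`. The result `none` means "fail". -/
noncomputable def pmidConstruction (G : MGraph K J) : Option (PatternGraph K) :=
  (Finset.univ : Finset (Pattern K)).toList.foldlM
    (fun H r => (missing r).toList.foldlM (constructionStep G r) H)
    { verts := Finset.univ, edges := ∅ }

/-! ### The PM-ID identification algorithm -/

/-- The vertices of the variables observed under the pattern `r`: `X_O(r)^(1)` and `O`. -/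
def observedVertices (J : ℕ) (r : Pattern K) : Finset (Vtx K J) :=
  (Finset.univ.filter fun k => r k = true).image Vtx.x ∪ Finset.univ.image Vtx.o

/-- The vertices of the variables missing under the pattern `r`: `X_M(r)^(1)`. -/
def missingVertices (J : ℕ) (r : Pattern K) : Finset (Vtx K J) := (missing r).image Vtx.x

/-- `m` is the density `p(X_O(r), O, R = r)` read off from the observed law `ν`. -/
structure IsObservedDensity (𝒮 : StateSpaces.{u} K J) (ν : Measure 𝒮.Obs) (r : Pattern K)
    (m : 𝒮.Full → ℝ≥0∞) : Prop where
  measurable : Measurable m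
  dependsOn : DependsOn m (observedVertices J r : Set (Vtx K J))
  density : ∀ B : Set 𝒮.Obs, MeasurableSet B → ∀ c,
    ν (B ∩ {y | ∀ k, (y (.r k) : ULift.{u} Bool).down = r k}) =
      lmarginal 𝒮.μ (observedVertices J r)
        (fun c' => B.indicator (fun _ => m c') (observe 𝒮 (withPattern 𝒮 r c'))) c

/-- One step of the PM-ID algorithm with the pattern DAG `H` and the observed law `ν`, at the
pattern `r`. It computes the extrapolation density `ext r` and the joint density `joint r` from
the joint densities of the parents of `r`.

* At the complete case pattern, the joint density is the observed density.
* At any other pattern, the extrapolation density is a conditional density of `X_M(r)^(1)` given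
  the other variables whose `i`-th Gibbs factor, for each `i ∈ M(r)`, is the `i`-th Gibbs factor
  of the joint density of a parent `s →^i r`; and the joint density is the product of the
  extrapolation density with the observed density `p(X_O(r), O, R = r)`. -/
def PMIDStep (𝒮 : StateSpaces.{u} K J) (H : PatternGraph K) (ν : Measure 𝒮.Obs)
    (joint ext : Pattern K → 𝒮.Full → ℝ≥0∞) (r : Pattern K) : Prop :=
  Measurable (joint r) ∧ ∃ m, IsObservedDensity 𝒮 ν r m ∧
    (r = complete K → joint r =ᵐ[𝒮.ref] m) ∧
    (r ≠ complete K →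
      Measurable (ext r) ∧
      lmarginal 𝒮.μ (missingVertices J r) (ext r) =ᵐ[𝒮.ref] 1 ∧
      (∀ i ∈ missing r, ∃ s, (s, i, r) ∈ H.edges ∧
        gibbs 𝒮 i (ext r) =ᵐ[𝒮.ref] gibbs 𝒮 i (joint s)) ∧
      joint r =ᵐ[𝒮.ref] fun c => ext r c * m c)

/-- The extrapolation density `p(X_M(r)^(1) | X_O(r)^(1), O, R = r)` of a model. -/
noncomputable def extrapolation (𝒮 : StateSpaces.{u} K J) (f : 𝒮.Full → ℝ≥0∞) (r : Pattern K) :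
    𝒮.Full → ℝ≥0∞ :=
  fun c => jointAt 𝒮 f r c / lmarginal 𝒮.μ (missingVertices J r) (jointAt 𝒮 f r) c

/-- `l` is a topological ordering of the vertices of `H`. -/
structure IsTopologicalOrder (H : PatternGraph K) (l : List (Pattern K)) : Prop where
  nodup : l.Nodup
  mem_iff : ∀ r, r ∈ l ↔ r ∈ H.verts
  forward : l.Pairwise fun a b => ¬ H.Adj b a

/-- The PM-ID algorithm with the pattern DAG `H`, run along any topological ordering of `H`,
identifies the joint densities `p(X^(1), O, R = r)`, for all vertices `r` of `H`, of the model
with density `f` from its observed law. -/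
structure PMIDIdentifies (𝒮 : StateSpaces.{u} K J) (H : PatternGraph K)
    (f : 𝒮.Full → ℝ≥0∞) : Prop where
  /-- The Gibbs factors of each pattern agree with those of each suitable parent. -/
  gibbs_eq : ∀ s i r, (s, i, r) ∈ H.edges →
    gibbs 𝒮 i (jointAt 𝒮 f r) =ᵐ[𝒮.ref] gibbs 𝒮 i (jointAt 𝒮 f s)
  /-- Topological orderings exist. -/
  exists_order : ∃ l, IsTopologicalOrder H l
  /-- Every topological ordering starts with the complete case pattern. -/
  first : ∀ l, IsTopologicalOrder H l → l.head? = some (complete K)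
  /-- The true densities carry out every step. -/
  correct : ∀ r ∈ H.verts,
    PMIDStep 𝒮 H (observedLaw 𝒮 f) (jointAt 𝒮 f) (extrapolation 𝒮 f) r
  /-- Nothing else carries out the steps up to any stage of the ordering: the steps determine the
  extrapolation densities and the joint densities. -/
  unique : ∀ l, IsTopologicalOrder H l → ∀ l', l' <+: l →
    ∀ joint ext : Pattern K → 𝒮.Full → ℝ≥0∞,
      (∀ r ∈ l', PMIDStep 𝒮 H (observedLaw 𝒮 f) joint ext r) →
      ∀ r ∈ l', joint r =ᵐ[𝒮.ref] jointAt 𝒮 f r ∧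
        (r ≠ complete K → ext r =ᵐ[𝒮.ref] extrapolation 𝒮 f r)

end Models

end MissingData

open MissingData

/-! Two independent facts carry the proof. The first is graphical. In each of the three
factorizations, a factor that involves both `X_i^(1)` and `R_i` would put `R_i` into the Markov
blanket of `X_i^(1)`. Under (S1) the density is therefore almost everywhere a product `g * h` with
`g` free of `R_i` and `h` free of `X_i^(1)` (`Splits`). In the `i`-th Gibbs factor `h` cancels, so
changing the `i`-th entry of the pattern leaves that factor unchanged (`Splits.gibbs_jointAt_eq`);
this justifies every edge of the construction.

The second is analytic. A density is determined by its Gibbs factors in the coordinates of `M` and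
its margin over `M`, relative to an almost everywhere positive density with the same Gibbs factors
(`eq_mul_lmarginal_div_of_gibbs_eq`). A conditional density has margin one, so its Gibbs factors
alone determine it.

The remaining ingredient is `p(X_O(r), O, R = r)`, which the observed law fixes almost everywhere
(`IsObservedDensity.ae_eq`, `isObservedDensity_lmarginal`). Parents of a pattern have fewer missing
entries, so induction on that number shows that the algorithm can only produce the true densities.
Two models with the same observed law then have the same full law. -/

namespace MissingData

/-! ### Marginals, null sets on slices, and densities determined by Gibbs factors -/

section Marginals

open Function

variable {V : Type} [DecidableEq V] {S : V → Type u}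

theorem updateFinset_apply_of_mem (c : ∀ v, S v) (A : Finset V) (y : ∀ v : A, S v) {v : V}
    (hv : v ∈ A) : updateFinset c A y v = y ⟨v, hv⟩ := by
  simp [updateFinset, hv]

theorem updateFinset_apply_of_notMem (c : ∀ v, S v) (A : Finset V) (y : ∀ v : A, S v) {v : V}
    (hv : v ∉ A) : updateFinset c A y v = c v := by
  simp [updateFinset, hv]

variable [∀ v, MeasurableSpace (S v)] {μ : ∀ v, Measure (S v)}

theorem dependsOn_lmarginal (A : Finset V) (f : (∀ v, S v) → ℝ≥0∞) :
    DependsOn (lmarginal μ A f) {v | v ∉ A} :=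
  fun _ _ h => lmarginal_congr μ f h

theorem lmarginal_dependsOn_of_dependsOn {A : Finset V} {f : (∀ v, S v) → ℝ≥0∞} {W : Set V}
    (hf : DependsOn f W) : DependsOn (lmarginal μ A f) (W \ A) := by
  intro x y h
  refine lintegral_congr fun z => hf fun v hv => ?_
  by_cases hA : v ∈ A
  · simp [updateFinset, hA]
  · simpa [updateFinset, hA] using h v ⟨hv, hA⟩

theorem lmarginal_mul_right {A : Finset V} {g h : (∀ v, S v) → ℝ≥0∞} (hg : Measurable g)
    (hh : DependsOn h {v | v ∉ A}) (c : ∀ v, S v) :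
    lmarginal μ A (fun c => g c * h c) c = lmarginal μ A g c * h c := by
  have key : ∀ y : ∀ v : A, S v, h (updateFinset c A y) = h c := fun y =>
    hh fun v hv => updateFinset_apply_of_notMem c A y hv
  simp only [lmarginal, key]
  exact lintegral_mul_const _ (hg.comp measurable_updateFinset)

variable [Fintype V] [∀ v, SigmaFinite (μ v)]

theorem lintegral_eq_lmarginal_compl (A : Finset V) {f : (∀ v, S v) → ℝ≥0∞} (hf : Measurable f)
    (c : ∀ v, S v) :
    ∫⁻ c, f c ∂(Measure.pi μ) = lmarginal μ Aᶜ (lmarginal μ A f) c := by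
  rw [lintegral_eq_lmarginal_univ c, ← lmarginal_union' μ f hf disjoint_compl_right,
    Finset.union_compl]

theorem lintegral_eq_zero_of_lmarginal {A : Finset V} {f : (∀ v, S v) → ℝ≥0∞}
    (hf : Measurable f) (h : ∀ c, lmarginal μ A f c = 0) : ∫⁻ c, f c ∂(Measure.pi μ) = 0 := by
  have := lintegral_eq_of_lmarginal_eq (μ := μ) A hf measurable_zero
    (funext fun c => (h c).trans (by simp [lmarginal]))
  simpa using this

/-- A measurable property holds almost everywhere if it does so on all slices. -/
theorem ae_of_forall_ae_updateFinset (A : Finset V) {p : (∀ v, S v) → Prop}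
    (hp : MeasurableSet {c | p c})
    (h : ∀ c, ∀ᵐ y ∂(Measure.pi fun v : A => μ v), p (updateFinset c A y)) :
    ∀ᵐ c ∂(Measure.pi μ), p c := by
  have h0 := lintegral_eq_zero_of_lmarginal (μ := μ) (A := A)
    (f := {c | ¬ p c}.indicator 1) (measurable_one.indicator hp.compl) fun c => by
      refine (lintegral_congr_ae ?_).trans lintegral_zero
      filter_upwards [h c] with y hy
      simp [hy]
  rwa [lintegral_indicator_one (s := {c | ¬ p c}) hp.compl] at h0

/-- A property that holds almost everywhere does so on almost all slices. -/
theorem ae_ae_updateFinset (A : Finset V) {p : (∀ v, S v) → Prop}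
    (h : ∀ᵐ c ∂(Measure.pi μ), p c) :
    ∀ᵐ c ∂(Measure.pi μ), ∀ᵐ y ∂(Measure.pi fun v : A => μ v), p (updateFinset c A y) := by
  -- The property need not be measurable, so its exceptional set is enlarged to a measurable null
  -- set.
  set N := toMeasurable (Measure.pi μ) {c | ¬ p c} with hN
  have hNm : MeasurableSet N := measurableSet_toMeasurable _ _
  have hN0 : Measure.pi μ N = 0 := by rw [hN, measure_toMeasurable]; exact h
  have hm : Measurable (N.indicator (1 : (∀ v, S v) → ℝ≥0∞)) := measurable_one.indicator hNm
  have hF : Measurable (lmarginal μ A (N.indicator 1)) := hm.lmarginal μ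
  -- Integrating the `A`-margin over `Aᶜ` already gives the measure of `N`, which is zero; the
  -- further integration over `A`, where the measure may be infinite, keeps it zero.
  have h0 : ∫⁻ c, lmarginal μ A (N.indicator 1) c ∂(Measure.pi μ) = 0 := by
    refine lintegral_eq_zero_of_lmarginal (A := Aᶜ) hF fun c => ?_
    rw [← lintegral_eq_lmarginal_compl A hm c, lintegral_indicator_one hNm, hN0]
  rw [lintegral_eq_zero_iff hF] at h0
  filter_upwards [h0] with c hc
  have hc' := (lintegral_eq_zero_iff (hm.comp measurable_updateFinset)).1 hc
  filter_upwards [hc'] with y hy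
  by_contra hpy
  have : updateFinset c A y ∈ N := subset_toMeasurable _ _ hpy
  simp [this] at hy

theorem lmarginal_ae_congr (A : Finset V) {f g : (∀ v, S v) → ℝ≥0∞}
    (h : f =ᵐ[Measure.pi μ] g) : lmarginal μ A f =ᵐ[Measure.pi μ] lmarginal μ A g := by
  filter_upwards [ae_ae_updateFinset A h] with c hc
  exact lintegral_congr_ae hc

/-- The `A`-margin is the integral of the `T`-margin over `A \ T`, and a function with finite
integral is finite almost everywhere; this applies on every slice. -/
theorem ae_lmarginal_ne_top {A T : Finset V} (hT : T ⊆ A) {g : (∀ v, S v) → ℝ≥0∞}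
    (hg : Measurable g) (h : ∀ c, lmarginal μ A g c ≠ ∞) :
    ∀ᵐ c ∂(Measure.pi μ), lmarginal μ T g c ≠ ∞ := by
  have hL : Measurable (lmarginal μ T g) := hg.lmarginal μ
  refine ae_of_forall_ae_updateFinset (A \ T) (hL (measurableSet_singleton ∞).compl) fun c => ?_
  have hc := h c
  rw [← Finset.union_sdiff_of_subset hT, lmarginal_union' μ g hg Finset.disjoint_sdiff] at hc
  exact (ae_lt_top (hL.comp measurable_updateFinset) hc).mono fun y hy => hy.ne

theorem ae_lmarginal_ne_zero (A : Finset V) {g : (∀ v, S v) → ℝ≥0∞}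
    (hg : Measurable g) (h : ∀ᵐ c ∂(Measure.pi μ), g c ≠ 0) :
    ∀ᵐ c ∂(Measure.pi μ), lmarginal μ A g c ≠ 0 := by
  -- If the measure on the `A`-coordinates vanishes, every margin is zero, but so is the whole
  -- product measure. Otherwise a zero margin would make `g` vanish almost everywhere on a slice of
  -- nonzero measure.
  by_cases hA : (Measure.pi fun v : A => μ v) = 0
  · have h0 : Measure.pi μ = 0 := by
      have := lintegral_eq_zero_of_lmarginal (μ := μ) (A := A) (f := fun _ => 1) measurable_one
        fun c => by simp [lmarginal, hA]
      simpa using this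
    simp [h0]
  · filter_upwards [ae_ae_updateFinset A h] with c hc h0
    have h1 := (lintegral_eq_zero_iff (hg.comp measurable_updateFinset)).1 h0
    apply hA
    rw [← ae_eq_bot, ← Filter.eventually_false_iff_eq_bot]
    filter_upwards [hc, h1] with y hy hy'
    exact hy hy'

/-- The common ratio is neither `0` nor `∞`, which rules out `x = ∞` and `x = 0`. Hence nothing has
to be assumed about the candidate density, only about the true one. -/
theorem eq_mul_div_of_div_eq_div {a b x y : ℝ≥0∞} (h : a / x = b / y) (hb : b ≠ 0) (hb' : b ≠ ∞)
    (hy : y ≠ 0) (hy' : y ≠ ∞) : a = b * (x / y) := by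
  have h1 : b / y ≠ 0 := ENNReal.div_ne_zero.2 ⟨hb, hy'⟩
  have h2 : b / y ≠ ∞ := ENNReal.div_ne_top hb' hy
  have hx : x ≠ ∞ := by rintro rfl; simp at h; exact h1 h.symm
  have hx0 : x ≠ 0 := by
    rintro rfl
    by_cases ha : a = 0
    · simp [ha] at h; exact h1 h.symm
    · rw [ENNReal.div_zero ha] at h; exact h2 h.symm
  calc a = a / x * x := (ENNReal.div_mul_cancel hx0 hx).symm
    _ = b * (x / y) := by rw [h, div_eq_mul_inv, div_eq_mul_inv]; ring

/-- A density is determined by its Gibbs factors in the coordinates `M` and its margin over `M`,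
relative to an almost everywhere positive density with the same Gibbs factors. -/
theorem eq_mul_lmarginal_div_of_gibbs_eq {g g' : (∀ v, S v) → ℝ≥0∞} (hg : Measurable g)
    (hg' : Measurable g') (M : Finset V) (hpos : ∀ᵐ c ∂(Measure.pi μ), g' c ≠ 0)
    (hfin : ∀ T ⊆ M, ∀ᵐ c ∂(Measure.pi μ), lmarginal μ T g' c ≠ ∞)
    (hgibbs : ∀ v ∈ M, (fun c => g c / lmarginal μ {v} g c) =ᵐ[Measure.pi μ]
      fun c => g' c / lmarginal μ {v} g' c) :
    g =ᵐ[Measure.pi μ] fun c => g' c * (lmarginal μ M g c / lmarginal μ M g' c) := by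
  have hg'fin : ∀ᵐ c ∂(Measure.pi μ), g' c ≠ ∞ := by simpa using hfin ∅ (by simp)
  suffices H : ∀ T ⊆ M, g =ᵐ[Measure.pi μ]
      fun c => g' c * (lmarginal μ T g c / lmarginal μ T g' c) from H M subset_rfl
  intro T
  induction T using Finset.induction with
  | empty =>
    intro _
    filter_upwards [hpos, hg'fin] with c h0 h1
    simp [ENNReal.mul_div_cancel h0 h1]
  | insert v T hv ih =>
    intro hT
    have hTM : T ⊆ M := (Finset.subset_insert v T).trans hT
    have hvM : {v} ⊆ M := by simpa using hT (Finset.mem_insert_self v T)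
    -- Equality of the `v`-th Gibbs factors says that `g / g'` is the ratio of the `v`-margins, a
    -- function free of the coordinate `v`.
    have hone : g =ᵐ[Measure.pi μ] fun c => g' c * (lmarginal μ {v} g c / lmarginal μ {v} g' c) := by
      filter_upwards [hpos, hg'fin, hgibbs v (hvM (by simp)), ae_lmarginal_ne_zero {v} hg' hpos,
        hfin _ hvM] with c h0 h1 h2 h3 h4
      exact eq_mul_div_of_div_eq_div h2 h0 h1 h3 h4
    -- The induction hypothesis expresses the same `g / g'` as the ratio of the `T`-margins, so the
    -- two ratios agree. Being free of `v`, the common ratio passes through integration over `v`,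
    -- which turns the `T`-margins into margins over `insert v T`.
    have hL : lmarginal μ T g =ᵐ[Measure.pi μ]
        fun c => lmarginal μ T g' c * (lmarginal μ {v} g c / lmarginal μ {v} g' c) := by
      filter_upwards [hpos, hg'fin, hone, ih hTM, ae_lmarginal_ne_zero T hg' hpos, hfin _ hTM]
        with c h0 h1 h2 h3 h4 h5
      have := (ENNReal.mul_right_inj h0 h1).1 (h3.symm.trans h2)
      rw [← this, ENNReal.mul_div_cancel h4 h5]
    have hL' := lmarginal_ae_congr {v} hL
    have hdisj : Disjoint ({v} : Finset V) T := by simpa using hv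
    filter_upwards [hone, hL', ae_lmarginal_ne_zero (insert v T) hg' hpos, hfin _ hT]
      with c h1 h2 h3 h4
    rw [lmarginal_mul_right (hg'.lmarginal μ)] at h2
    · rw [← lmarginal_union μ g hg hdisj, ← lmarginal_union μ g' hg' hdisj,
        ← Finset.insert_eq] at h2
      rw [h1, h2, ENNReal.mul_div_right_comm, ENNReal.div_self h3 h4, one_mul]
    · intro x y hxy
      exact congrArg₂ (· / ·) (dependsOn_lmarginal {v} g hxy) (dependsOn_lmarginal {v} g' hxy)

end Marginals

end MissingData
-- Splitting of the factorized densities under Markov blanket separation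
namespace MissingData

theorem reflTransGen_symm {V : Type} {r : V → V → Prop} (hr : ∀ v w, r v w → r w v) {v w : V}
    (h : Relation.ReflTransGen r v w) : Relation.ReflTransGen r w v := by
  induction h with
  | refl => exact .refl
  | tail _ h ih => exact .head (hr _ _ h) ih

section Splitting

variable {V : Type} {S : V → Type u} [∀ v, MeasurableSpace (S v)]

/-- `f` is the product of a function without the coordinate `b` and one without the
coordinate `a`. -/
def Splits (a b : V) (f : (∀ v, S v) → ℝ≥0∞) : Prop :=
  ∃ g h : (∀ v, S v) → ℝ≥0∞, Measurable g ∧ Measurable h ∧ DependsOn g {v | v ≠ b} ∧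
    DependsOn h {v | v ≠ a} ∧ f = fun c => g c * h c

/-- A factor missing one of the two coordinates goes wholly into the matching slot, with `1` in the
other. -/
theorem Splits.of_dependsOn {a b : V} {f : (∀ v, S v) → ℝ≥0∞} {W : Set V} (hf : Measurable f)
    (hW : DependsOn f W) (hab : a ∈ W → b ∉ W) : Splits a b f := by
  by_cases ha : a ∈ W
  · refine ⟨f, fun _ => 1, hf, measurable_const, hW.mono ?_, fun _ _ _ => rfl, by simp⟩
    rintro v hv rfl
    exact hab ha hv
  · refine ⟨fun _ => 1, f, measurable_const, hf, fun _ _ _ => rfl, hW.mono ?_, by simp⟩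
    rintro v hv rfl
    exact ha hv

theorem Splits.mul {a b : V} {f f' : (∀ v, S v) → ℝ≥0∞} (hf : Splits a b f)
    (hf' : Splits a b f') : Splits a b fun c => f c * f' c := by
  obtain ⟨g, h, hg, hh, hgb, hha, rfl⟩ := hf
  obtain ⟨g', h', hg', hh', hgb', hha', rfl⟩ := hf'
  refine ⟨fun c => g c * g' c, fun c => h c * h' c, hg.mul hg', hh.mul hh',
    fun x y hxy => congrArg₂ (· * ·) (hgb hxy) (hgb' hxy),
    fun x y hxy => congrArg₂ (· * ·) (hha hxy) (hha' hxy), funext fun c => ?_⟩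
  ring

theorem Splits.prod {ι : Type*} {a b : V} (s : Finset ι) {k : ι → (∀ v, S v) → ℝ≥0∞}
    (hk : ∀ j ∈ s, Splits a b (k j)) : Splits a b fun c => ∏ j ∈ s, k j c := by
  classical
  induction s using Finset.induction with
  | empty =>
    exact Splits.of_dependsOn (W := ∅) (by simp) (fun _ _ _ => by simp) (by simp)
  | insert j s hj ih =>
    simp only [Finset.prod_insert hj]
    exact (hk j (by simp)).mul (ih fun i hi => hk i (by simp [hi]))

variable [Fintype V] [DecidableEq V] {μ : ∀ v, Measure (S v)} {f : (∀ v, S v) → ℝ≥0∞}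

/-- Two distinct vertices in one family `{v} ∪ pa(v)` are parent and child or co-parents. -/
theorem DAGFactorizes.exists_splits {dir : V → V → Prop} (hf : DAGFactorizes dir μ f) {a b : V}
    (hne : b ≠ a) (hab : b ∉ dagBlanket dir a) :
    ∃ f', Splits a b f' ∧ f =ᵐ[Measure.pi μ] f' := by
  obtain ⟨k, hk, hfk⟩ := hf
  refine ⟨_, Splits.prod Finset.univ fun v _ =>
    Splits.of_dependsOn (hk v).measurable (hk v).dependsOn fun ha hb => hab ?_, hfk⟩
  refine ⟨?_, hne⟩
  simp only [Finset.coe_singleton, Set.mem_union, Set.mem_singleton_iff, parents,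
    Set.mem_ofPred_eq] at ha hb
  rcases ha with rfl | ha <;> rcases hb with rfl | hb
  · exact absurd rfl hne
  · exact Or.inl (Or.inl hb)
  · exact Or.inl (Or.inr ha)
  · exact Or.inr ⟨v, hb, ha⟩

/-- Only the top-level district factorization is needed. If `a` and `b` both lie in `D ∪ pa(D)`,
then `b` is in the boundary of `a` when `a ∈ D`, and otherwise in the boundary of a child of `a` in
`D`. -/
theorem NestedMarkov.exists_splits {dir bi : V → V → Prop} (hbi : ∀ v w, bi v w → bi w v)
    (hf : NestedMarkov dir bi μ Finset.univ f) {a b : V}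
    (hne : b ≠ a) (hab : b ∉ admgBlanket dir bi a) :
    ∃ f', Splits a b f' ∧ f =ᵐ[Measure.pi μ] f' := by
  obtain ⟨_, _, -, qD, hD, hfD, -, -, -, -⟩ := hf
  refine ⟨_, Splits.prod _ fun D hDm =>
    Splits.of_dependsOn (hD D hDm).measurable (hD D hDm).dependsOn fun ha hb => hab ?_, hfD⟩
  refine ⟨?_, hne⟩
  classical
  obtain ⟨v, -, rfl⟩ := Finset.mem_image.1 hDm
  have hreach : ∀ w : V, Relation.ReflTransGen
      (fun a b => a ∈ Finset.univ ∧ b ∈ Finset.univ ∧ bi a b) v w ↔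
      Relation.ReflTransGen bi v w := by simp
  have key : ∀ d, Relation.ReflTransGen bi v d → b ∈ boundary dir bi d := by
    intro d hd
    have hdv := reflTransGen_symm hbi hd
    rcases hb with hb | ⟨-, e, he, heb⟩
    · simp only [Finset.coe_filter, Finset.mem_univ, true_and, Set.mem_ofPred_eq] at hb
      exact Or.inl (Or.inr (hdv.trans hb))
    · simp only [Finset.mem_filter, Finset.mem_univ, true_and] at he
      exact Or.inr (Set.mem_biUnion (show e ∈ district bi d from hdv.trans he) heb)
  rcases ha with ha | ⟨-, e, he, hea⟩
  · simp only [Finset.coe_filter, Finset.mem_univ, true_and, Set.mem_ofPred_eq] at ha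
    exact Or.inl (Or.inl (key a ha))
  · simp only [Finset.mem_filter, Finset.mem_univ, true_and] at he
    exact Or.inr (Set.mem_biUnion (show e ∈ children dir a from hea) (key e he))

theorem CGFactorizes.exists_splits [∀ v, SigmaFinite (μ v)] {dir und : V → V → Prop}
    (hund : ∀ v w, und v w → und w v) (hf : CGFactorizes dir und μ f) {a b : V}
    (hne : b ≠ a) (hab : b ∉ cgBlanket dir und a) :
    ∃ f', Splits a b f' ∧ f =ᵐ[Measure.pi μ] f' := by
  obtain ⟨φ, hφ, hff⟩ := hf
  -- Parents of one chain component are co-parents in the chain graph sense, since their children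
  -- are joined by an undirected path. This handles both the moral edges and the normalizer.
  have hparents : ∀ τ ∈ chainComponents und, a ∈ outerParents dir τ →
      b ∉ outerParents dir τ := by
    classical
    rintro τ hτ ⟨-, e, he, hae⟩ ⟨-, d, hd, hbd⟩
    obtain ⟨v, -, rfl⟩ := Finset.mem_image.1 hτ
    simp only [Finset.mem_filter, Finset.mem_univ, true_and] at he hd
    exact hab ⟨Or.inr ⟨d, e, hbd, (reflTransGen_symm hund hd).trans he, hae⟩, hne⟩
  have hφm : ∀ τ A, Measurable fun c => (φ τ A c : ℝ≥0∞) := fun τ A =>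
    (hφ τ A).1.coe_nnreal_ennreal
  have hφd : ∀ τ A, DependsOn (fun c => (φ τ A c : ℝ≥0∞)) (A : Set V) := fun τ A x y hxy =>
    congrArg _ ((hφ τ A).2 hxy)
  refine ⟨_, Splits.prod _ fun τ hτ => ?_, hff⟩
  simp only [div_eq_mul_inv]
  refine Splits.mul (Splits.prod _ fun A hA => ?_) ?_
  · refine Splits.of_dependsOn (hφm τ A) (hφd τ A) fun ha hb => ?_
    simp only [moralCliques, Finset.mem_filter, Finset.mem_univ, true_and] at hA
    rcases hA.2 a ha b hb hne.symm with ⟨h1, h2⟩ | h | h | h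
    · exact hparents τ hτ h1 h2
    · exact hab ⟨Or.inl (Or.inr h), hne⟩
    · exact hab ⟨Or.inl (Or.inl (Or.inl h)), hne⟩
    · exact hab ⟨Or.inl (Or.inl (Or.inr (hund _ _ h))), hne⟩
  -- The normalizer integrates out `τ`, so only the outer parents remain.
  · refine Splits.of_dependsOn (W := outerParents dir τ) ?_ ?_ (hparents τ hτ)
    · exact ((Finset.measurable_prod _ fun A _ => hφm τ A).lmarginal μ).inv
    · have h0 : DependsOn (fun c => ∏ A ∈ moralCliques dir und τ, (φ τ A c : ℝ≥0∞))
          ((τ : Set V) ∪ outerParents dir τ) := fun x y hxy =>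
        Finset.prod_congr rfl fun A hA => hφd τ A fun v hv =>
          hxy v (by
            simp only [moralCliques, Finset.mem_filter] at hA
            exact hA.2.1 v hv)
      intro x y hxy
      refine congrArg _ (lmarginal_dependsOn_of_dependsOn h0 fun v hv => hxy v ?_)
      exact hv.1.resolve_left hv.2

end Splitting

end MissingData
-- The constructed pattern graph and its orderings
namespace MissingData

section Construction

variable {K J : ℕ}

/-- The graph on all patterns whose edges `a →^i b` make one missing index `i` of `b` observed. -/
def IsOneStepGraph (H : PatternGraph K) : Prop :=
  H.verts = Finset.univ ∧
    ∀ a i b, (a, i, b) ∈ H.edges ↔ b i = false ∧ a = Function.update b i true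

theorem mem_missing {r : Pattern K} {i : Fin K} : i ∈ missing r ↔ r i = false := by
  simp [missing]

/-- By (S1) the guard always succeeds, so the loop merely collects edges; the starting graph is
arbitrary to allow induction. -/
theorem foldlM_constructionStep {G : MGraph K J} (hS1 : G.S1) (r : Pattern K)
    (L : List (Fin K)) (H : PatternGraph K) :
    ∃ H', L.foldlM (constructionStep G r) H = some H' ∧ H'.verts = H.verts ∧
      ∀ e, e ∈ H'.edges ↔ e ∈ H.edges ∨ ∃ i ∈ L, e = (Function.update r i true, i, r) := by
  induction L generalizing H with
  | nil => exact ⟨H, rfl, rfl, by simp⟩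
  | cons i L ih =>
    obtain ⟨H', h1, h2, h3⟩ :=
      ih { H with edges := insert (Function.update r i true, i, r) H.edges }
    refine ⟨H', ?_, h2, fun e => ?_⟩
    · rw [List.foldlM_cons, constructionStep, if_pos (hS1 i)]
      exact h1
    · rw [h3]
      simp only [Finset.mem_insert, List.mem_cons, exists_eq_or_imp]
      tauto

theorem foldlM_foldlM_constructionStep {G : MGraph K J} (hS1 : G.S1) (L : List (Pattern K))
    (H : PatternGraph K) :
    ∃ H', L.foldlM (fun H r => (missing r).toList.foldlM (constructionStep G r) H) H = some H' ∧
      H'.verts = H.verts ∧ ∀ e, e ∈ H'.edges ↔ e ∈ H.edges ∨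
        ∃ r ∈ L, ∃ i ∈ missing r, e = (Function.update r i true, i, r) := by
  induction L generalizing H with
  | nil => exact ⟨H, rfl, rfl, by simp⟩
  | cons r L ih =>
    obtain ⟨H₁, h1, h2, h3⟩ := foldlM_constructionStep hS1 r (missing r).toList H
    obtain ⟨H', h1', h2', h3'⟩ := ih H₁
    refine ⟨H', ?_, h2'.trans h2, fun e => ?_⟩
    · rw [List.foldlM_cons, h1]
      exact h1'
    · rw [h3', h3]
      simp only [Finset.mem_toList, List.mem_cons, exists_eq_or_imp]
      exact or_assoc

theorem exists_pmidConstruction {G : MGraph K J} (hS1 : G.S1) :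
    ∃ H, pmidConstruction G = some H ∧ IsOneStepGraph H := by
  obtain ⟨H, h1, h2, h3⟩ := foldlM_foldlM_constructionStep hS1
    (Finset.univ : Finset (Pattern K)).toList { verts := Finset.univ, edges := ∅ }
  refine ⟨H, h1, h2, fun a i b => ?_⟩
  rw [h3]
  simp only [Finset.notMem_empty, false_or, Finset.mem_toList, Finset.mem_univ, true_and,
    mem_missing, Prod.mk.injEq]
  constructor
  · rintro ⟨r, j, hj, rfl, rfl, rfl⟩
    exact ⟨hj, rfl⟩
  · rintro ⟨hi, rfl⟩
    exact ⟨b, i, hi, rfl, rfl, rfl⟩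

/-- The number of missing entries is the rank function behind acyclicity, reachability, topological
orderings and the final induction. -/
theorem card_missing_update_lt {r : Pattern K} {i : Fin K} (hi : r i = false) :
    (missing (Function.update r i true)).card < (missing r).card := by
  refine Finset.card_lt_card (Finset.ssubset_iff_of_subset ?_ |>.2 ⟨i, mem_missing.2 hi, ?_⟩)
  · intro j hj
    rw [mem_missing] at hj ⊢
    by_cases h : j = i
    · simp [h] at hj
    · simpa [h] using hj
  · simp [mem_missing]

theorem exists_missing_of_ne_complete {r : Pattern K} (hr : r ≠ complete K) :
    ∃ i, r i = false := by
  by_contra! h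
  exact hr (funext fun i => by simpa [complete] using h i)

variable {H : PatternGraph K}

theorem IsOneStepGraph.card_lt (hH : IsOneStepGraph H) {a b : Pattern K} (h : H.Adj a b) :
    (missing a).card < (missing b).card := by
  obtain ⟨i, hi⟩ := h
  obtain ⟨hb, rfl⟩ := (hH.2 _ _ _).1 hi
  exact card_missing_update_lt hb

theorem IsOneStepGraph.acyclic (hH : IsOneStepGraph H) (a : Pattern K) :
    ¬ Relation.TransGen H.Adj a a := by
  have key : ∀ b, Relation.TransGen H.Adj a b → (missing a).card < (missing b).card := by
    intro b hb
    induction hb with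
    | single h => exact hH.card_lt h
    | tail _ h ih => exact ih.trans (hH.card_lt h)
  exact fun h => lt_irrefl _ (key a h)

theorem IsOneStepGraph.edge_mem (hH : IsOneStepGraph H) {a b : Pattern K} {i : Fin K}
    (h : (a, i, b) ∈ H.edges) : a ∈ H.verts ∧ b ∈ H.verts ∧ a ≠ b := by
  refine ⟨hH.1 ▸ Finset.mem_univ _, hH.1 ▸ Finset.mem_univ _, ?_⟩
  rintro rfl
  exact lt_irrefl _ (hH.card_lt ⟨i, h⟩)

theorem IsOneStepGraph.reachable (hH : IsOneStepGraph H) (r : Pattern K) :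
    Relation.ReflTransGen H.Adj (complete K) r := by
  induction h : (missing r).card using Nat.strong_induction_on generalizing r with
  | _ n ih =>
    by_cases hr : r = complete K
    · rw [hr]
    · obtain ⟨i, hi⟩ := exists_missing_of_ne_complete hr
      exact (ih _ (h ▸ card_missing_update_lt hi) _ rfl).tail ⟨i, (hH.2 _ _ _).2 ⟨hi, rfl⟩⟩

theorem IsOneStepGraph.pmidCompatible (hH : IsOneStepGraph H) : PMIDCompatible H where
  root_mem := hH.1 ▸ Finset.mem_univ _
  root a i h := by simpa [complete] using ((hH.2 _ _ _).1 h).1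
  path r _ i hi :=
    ⟨Function.update r i true, hH.reachable _, (hH.2 _ _ _).2 ⟨mem_missing.1 hi, rfl⟩⟩

theorem IsOneStepGraph.exists_topologicalOrder (hH : IsOneStepGraph H) :
    ∃ l, IsTopologicalOrder H l := by
  classical
  let rel : Pattern K → Pattern K → Prop := fun a b => (missing a).card ≤ (missing b).card
  have : Std.Total rel := ⟨fun a b => le_total _ _⟩
  have : IsTrans (Pattern K) rel := ⟨fun _ _ _ h h' => le_trans h h'⟩
  have hperm := List.perm_insertionSort rel (Finset.univ : Finset (Pattern K)).toList
  refine ⟨List.insertionSort rel (Finset.univ : Finset (Pattern K)).toList,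
    hperm.nodup_iff.2 (Finset.nodup_toList _), fun r => ?_, ?_⟩
  · simp [hH.1]
  · exact (List.pairwise_insertionSort rel _).imp fun h h' => absurd (hH.card_lt h') (not_lt.2 h)

/-- An incomplete pattern has a parent, which would have to precede it. -/
theorem IsOneStepGraph.head?_eq (hH : IsOneStepGraph H) {l : List (Pattern K)}
    (hl : IsTopologicalOrder H l) : l.head? = some (complete K) := by
  cases l with
  | nil =>
    have := (hl.mem_iff (complete K)).2 (hH.1 ▸ Finset.mem_univ _)
    simp at this
  | cons r l =>
    rw [List.head?_cons]
    by_contra hne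
    obtain ⟨i, hi⟩ := exists_missing_of_ne_complete fun h => hne (congrArg some h)
    have hedge := (hH.2 _ _ _).2 ⟨hi, rfl⟩
    have hmem := (hl.mem_iff (Function.update r i true)).2 (hH.edge_mem hedge).1
    rcases List.mem_cons.1 hmem with h | h
    · exact (hH.edge_mem hedge).2.2 h
    · exact (List.pairwise_cons.1 hl.forward).1 _ h ⟨i, hedge⟩

/-- Initial segments are closed under parents, so the algorithm can be analysed when stopped at any
stage. -/
theorem IsTopologicalOrder.mem_prefix_of_adj {l l' : List (Pattern K)}
    (hl : IsTopologicalOrder H l) (hl' : l' <+: l) {s r : Pattern K} (hs : s ∈ H.verts)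
    (hr : r ∈ l') (h : H.Adj s r) : s ∈ l' := by
  obtain ⟨t, rfl⟩ := hl'
  rcases List.mem_append.1 ((hl.mem_iff s).2 hs) with h' | h'
  · exact h'
  · exact absurd h ((List.pairwise_append.1 hl.forward).2.2 r hr s h')

end Construction

end MissingData
-- Restriction to a pattern and invariance of Gibbs factors
namespace MissingData

section Patterns

open Function

variable {K J : ℕ} {𝒮 : StateSpaces.{u} K J}

theorem measurableSet_ulift_bool (s : Set (ULift.{u} Bool)) : MeasurableSet s :=
  show MeasurableSet (ULift.up ⁻¹' s) from MeasurableSet.of_discrete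

instance : MeasurableSingletonClass (ULift.{u} Bool) := ⟨fun _ => measurableSet_ulift_bool _⟩

instance (𝒮 : StateSpaces.{u} K J) (v : Vtx K J) : SigmaFinite (𝒮.μ v) :=
  match v with
  | .x k => 𝒮.sigmaFiniteX k
  | .o j => 𝒮.sigmaFiniteO j
  | .r _ => inferInstanceAs (SigmaFinite (Measure.count : Measure (ULift.{u} Bool)))

theorem mem_indicatorVertices {v : Vtx K J} :
    v ∈ indicatorVertices K J ↔ ∃ k, v = .r k := by
  simp [indicatorVertices, eq_comm]

theorem x_notMem_indicatorVertices (k : Fin K) : (.x k : Vtx K J) ∉ indicatorVertices K J := by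
  simp [mem_indicatorVertices]

theorem withPattern_of_notMem (r : Pattern K) (c : 𝒮.Full) {v : Vtx K J}
    (hv : v ∉ indicatorVertices K J) : withPattern 𝒮 r c v = c v := by
  cases v with
  | x k => rfl
  | o j => rfl
  | r k => exact absurd (mem_indicatorVertices.2 ⟨k, rfl⟩) hv

theorem withPattern_congr {r s : Pattern K} {c d : 𝒮.Full} {v : Vtx K J} (hc : c v = d v)
    (hr : ∀ k, v = .r k → r k = s k) : withPattern 𝒮 r c v = withPattern 𝒮 s d v := by
  cases v with
  | x k => exact hc
  | o j => exact hc
  | r k => exact congrArg ULift.up (hr k rfl)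

theorem measurable_withPattern (r : Pattern K) : Measurable (withPattern 𝒮 r) := by
  refine measurable_pi_iff.2 fun v => ?_
  cases v with
  | x k => exact measurable_pi_apply (Vtx.x k : Vtx K J)
  | o j => exact measurable_pi_apply (Vtx.o j : Vtx K J)
  | r k => exact measurable_const

theorem withPattern_self (c : 𝒮.Full) :
    withPattern 𝒮 (fun k => (c (.r k) : ULift.{u} Bool).down) c = c := by
  funext v
  cases v <;> rfl

theorem dependsOn_comp_withPattern {β : Type*} (F : 𝒮.Full → β) (r : Pattern K) :
    DependsOn (fun c => F (withPattern 𝒮 r c)) {v | v ∉ indicatorVertices K J} := by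
  intro c d h
  refine congrArg F (funext fun v => ?_)
  by_cases hv : v ∈ indicatorVertices K J
  · obtain ⟨k, rfl⟩ := mem_indicatorVertices.1 hv
    rfl
  · rw [withPattern_of_notMem r c hv, withPattern_of_notMem r d hv, h v hv]

theorem updateFinset_indicatorVertices (r : Pattern K) (c : 𝒮.Full) :
    updateFinset c (indicatorVertices K J) (fun v => withPattern 𝒮 r c v) =
      withPattern 𝒮 r c := by
  funext v
  by_cases hv : v ∈ indicatorVertices K J
  · rw [updateFinset_apply_of_mem _ _ _ hv]
  · rw [updateFinset_apply_of_notMem _ _ _ hv, withPattern_of_notMem r c hv]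

/-- Patterns are atoms of mass one for the counting measure; this is what lets almost everywhere
statements be restricted to a fixed pattern. -/
theorem pi_indicatorVertices_singleton (y : ∀ v : indicatorVertices K J, 𝒮.St v) :
    (Measure.pi fun v : indicatorVertices K J => 𝒮.μ v) {y} = 1 := by
  rw [Measure.pi_singleton]
  refine Finset.prod_eq_one fun v _ => ?_
  obtain ⟨v, hv⟩ := v
  obtain ⟨k, rfl⟩ := mem_indicatorVertices.1 hv
  exact Measure.count_singleton (α := ULift.{u} Bool) _

theorem measurableSet_indicatorVertices_singleton (y : ∀ v : indicatorVertices K J, 𝒮.St v) :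
    MeasurableSet {y} := by
  rw [← Set.univ_pi_singleton]
  refine MeasurableSet.univ_pi fun v => ?_
  obtain ⟨v, hv⟩ := v
  obtain ⟨k, rfl⟩ := mem_indicatorVertices.1 hv
  exact measurableSet_ulift_bool _

/-- A property that holds almost everywhere holds almost everywhere for each pattern. -/
theorem ae_withPattern (r : Pattern K) {p : 𝒮.Full → Prop} (h : ∀ᵐ c ∂𝒮.ref, p c) :
    ∀ᵐ c ∂𝒮.ref, p (withPattern 𝒮 r c) := by
  filter_upwards [ae_ae_updateFinset (indicatorVertices K J) h] with c hc
  by_contra hp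
  -- An exception at pattern `r` would put an atom of mass one inside a null set of the slice.
  have : (Measure.pi fun v : indicatorVertices K J => 𝒮.μ v)
      {fun v : indicatorVertices K J => withPattern 𝒮 r c v} = 0 := by
    refine measure_mono_null (Set.singleton_subset_iff.2 ?_) hc
    simpa [updateFinset_indicatorVertices] using hp
  rw [pi_indicatorVertices_singleton] at this
  exact one_ne_zero this

open Classical in
theorem lmarginal_indicatorVertices_ite (r : Pattern K) (F : 𝒮.Full → ℝ≥0∞) (c : 𝒮.Full) :
    lmarginal 𝒮.μ (indicatorVertices K J)
      (fun c => if ∀ k, (c (.r k) : ULift.{u} Bool).down = r k then F c else 0) c =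
      F (withPattern 𝒮 r c) := by
  have h : ∀ y : ∀ v : indicatorVertices K J, 𝒮.St v,
      (if ∀ k, (updateFinset c (indicatorVertices K J) y (.r k) : ULift.{u} Bool).down = r k
        then F (updateFinset c (indicatorVertices K J) y) else 0) =
      Set.indicator {fun v : indicatorVertices K J => withPattern 𝒮 r c v} (fun _ => F (withPattern 𝒮 r c)) y := by
    intro y
    by_cases hy : y = fun v : indicatorVertices K J => withPattern 𝒮 r c v
    · subst hy
      simp only [updateFinset_indicatorVertices]
      rw [Set.indicator_of_mem (Set.mem_singleton _)]
      exact if_pos fun k => rfl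
    · rw [Set.indicator_of_notMem (by simpa using hy), if_neg]
      intro h
      refine hy (funext fun v => ?_)
      obtain ⟨v, hv⟩ := v
      obtain ⟨k, rfl⟩ := mem_indicatorVertices.1 hv
      have := h k
      rw [updateFinset_apply_of_mem _ _ _ hv] at this
      exact ULift.ext _ _ this
  simp only [lmarginal]
  rw [lintegral_congr h, lintegral_indicator_const (measurableSet_indicatorVertices_singleton _),
    pi_indicatorVertices_singleton, mul_one]

theorem le_lmarginal_indicatorVertices (r : Pattern K) (F : 𝒮.Full → ℝ≥0∞) (c : 𝒮.Full) :
    F (withPattern 𝒮 r c) ≤ lmarginal 𝒮.μ (indicatorVertices K J) F c := by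
  classical
  rw [← lmarginal_indicatorVertices_ite r F c]
  refine lmarginal_mono (fun d => ?_) c
  dsimp only
  split_ifs <;> simp

variable {f : 𝒮.Full → ℝ≥0∞}

theorem measurable_jointAt (hf : Measurable f) (r : Pattern K) : Measurable (jointAt 𝒮 f r) :=
  hf.comp (measurable_withPattern r)

/-- One pattern contributes at most the sum over all patterns, whose integral is the total mass. -/
theorem lmarginal_jointAt_ne_top (hf : Measurable f) (hfin : ∫⁻ c, f c ∂𝒮.ref ≠ ∞)
    (r : Pattern K) (c : 𝒮.Full) :
    lmarginal 𝒮.μ (indicatorVertices K J)ᶜ (jointAt 𝒮 f r) c ≠ ∞ := by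
  rw [lintegral_eq_lmarginal_compl (indicatorVertices K J) hf c] at hfin
  exact ne_top_of_le_ne_top hfin
    (lmarginal_mono (fun d => le_lmarginal_indicatorVertices r f d) c)

theorem ae_lmarginal_jointAt_ne_top (hf : Measurable f) (hfin : ∫⁻ c, f c ∂𝒮.ref ≠ ∞)
    (r : Pattern K) {T : Finset (Vtx K J)} (hT : Disjoint T (indicatorVertices K J)) :
    ∀ᵐ c ∂𝒮.ref, lmarginal 𝒮.μ T (jointAt 𝒮 f r) c ≠ ∞ :=
  ae_lmarginal_ne_top (Finset.subset_compl_iff_disjoint_right.2 hT) (measurable_jointAt hf r)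
    (lmarginal_jointAt_ne_top hf hfin r)

/-- The part `h` is constant in `x_i`, leaves the integral and cancels. The part `g` ignores `r_i`,
the only entry in which `a` and `b` may differ. -/
theorem Splits.gibbs_jointAt_eq {f' : 𝒮.Full → ℝ≥0∞} {i : Fin K}
    (hs : Splits (.x i) (.r i) f') (hff' : f =ᵐ[𝒮.ref] f') (hf : Measurable f)
    (hfin : ∫⁻ c, f c ∂𝒮.ref ≠ ∞) {a b : Pattern K} (hab : ∀ j, j ≠ i → a j = b j) :
    ∀ᵐ c ∂𝒮.ref, gibbsDenom 𝒮 i (jointAt 𝒮 f a) c ≠ 0 →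
      gibbsDenom 𝒮 i (jointAt 𝒮 f b) c ≠ 0 →
      gibbs 𝒮 i (jointAt 𝒮 f a) c = gibbs 𝒮 i (jointAt 𝒮 f b) c := by
  obtain ⟨g, h, hg, -, hgb, hha, rfl⟩ := hs
  have hgab : (fun c => g (withPattern 𝒮 a c)) = fun c => g (withPattern 𝒮 b c) := by
    funext c
    refine hgb fun v hv => withPattern_congr rfl fun k hk => hab k ?_
    rintro rfl
    exact hv hk
  have hprod : ∀ p : Pattern K, jointAt 𝒮 f p =ᵐ[𝒮.ref]
      fun c => g (withPattern 𝒮 p c) * h (withPattern 𝒮 p c) := fun p => ae_withPattern p hff'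
  have hden : ∀ p : Pattern K, gibbsDenom 𝒮 i (jointAt 𝒮 f p) =ᵐ[𝒮.ref] fun c =>
      lmarginal 𝒮.μ {.x i} (fun c => g (withPattern 𝒮 p c)) c * h (withPattern 𝒮 p c) := by
    intro p
    filter_upwards [lmarginal_ae_congr {.x i} (hprod p)] with c hc
    rw [gibbsDenom, hc]
    refine lmarginal_mul_right (g := fun c => g (withPattern 𝒮 p c))
      (h := fun c => h (withPattern 𝒮 p c)) (hg.comp (measurable_withPattern p))
      (fun x y hxy => ?_) c
    refine hha fun v hv => withPattern_congr (hxy v ?_) fun _ _ => rfl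
    simpa using hv
  have hdisj : Disjoint {(.x i : Vtx K J)} (indicatorVertices K J) :=
    Finset.disjoint_singleton_left.2 (x_notMem_indicatorVertices i)
  have key : ∀ p : Pattern K, ∀ᵐ c ∂𝒮.ref, gibbsDenom 𝒮 i (jointAt 𝒮 f p) c ≠ 0 →
      gibbs 𝒮 i (jointAt 𝒮 f p) c = g (withPattern 𝒮 p c) /
        lmarginal 𝒮.μ {.x i} (fun c => g (withPattern 𝒮 p c)) c := by
    intro p
    filter_upwards [hprod p, hden p, ae_lmarginal_jointAt_ne_top hf hfin p hdisj]
      with c h1 h2 h3 h4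
    change gibbsDenom 𝒮 i (jointAt 𝒮 f p) c ≠ ∞ at h3
    rw [h2] at h3 h4
    rw [gibbs, h1, h2]
    have h5 := mul_ne_zero_iff.1 h4
    -- Cancelling `h` needs `h ≠ 0` and `h ≠ ∞`: the first since the denominator is nonzero, the
    -- second since it is finite almost everywhere.
    refine ENNReal.mul_div_mul_right _ _ h5.2 fun h6 => h3 ?_
    rw [h6, ENNReal.mul_top h5.1]
  filter_upwards [key a, key b] with c ha hb ha0 hb0
  rw [ha ha0, hb hb0, hgab, congrFun hgab c]

theorem MGraph.Factorizes.exists_splits {G : MGraph K J} (hS1 : G.S1) (hf : G.Factorizes 𝒮 f)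
    (i : Fin K) : ∃ f', Splits (.x i) (.r i) f' ∧ f =ᵐ[𝒮.ref] f' := by
  cases G with
  | dag G => exact DAGFactorizes.exists_splits hf (by simp) (hS1 i)
  | admg G => exact NestedMarkov.exists_splits G.bi_symm hf (by simp) (hS1 i)
  | cg G => exact CGFactorizes.exists_splits G.und_symm hf (by simp) (hS1 i)

theorem IsOneStepGraph.isPatternDAG {H : PatternGraph K} (hH : IsOneStepGraph H)
    {G : MGraph K J} (hS1 : G.S1) : IsPatternDAG.{u} G H where
  edge_mem _ _ _ h := hH.edge_mem h
  acyclic := hH.acyclic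
  gibbs_eq a i b h 𝒮 f hf hG := by
    obtain ⟨f', hs, hff'⟩ := hG.exists_splits hS1 i
    obtain ⟨-, rfl⟩ := (hH.2 _ _ _).1 h
    exact hs.gibbs_jointAt_eq hff' hf.measurable (by simp [hf.lintegral_eq_one])
      fun j hj => by simp [hj]

end Patterns

end MissingData
-- Observed densities and identification of the full law
namespace MissingData

section Identification

open Function

variable {K J : ℕ} {𝒮 : StateSpaces.{u} K J}

theorem x_mem_observedVertices {r : Pattern K} {k : Fin K} :
    (.x k : Vtx K J) ∈ observedVertices J r ↔ r k = true := by
  simp [observedVertices]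

theorem o_mem_observedVertices (r : Pattern K) (j : Fin J) :
    (.o j : Vtx K J) ∈ observedVertices J r := by
  simp [observedVertices]

theorem x_mem_missingVertices {r : Pattern K} {k : Fin K} :
    (.x k : Vtx K J) ∈ missingVertices J r ↔ k ∈ missing r := by
  simp [missingVertices]

theorem disjoint_observedVertices_missingVertices (r : Pattern K) :
    Disjoint (observedVertices J r) (missingVertices J r) := by
  rw [Finset.disjoint_left]
  rintro (k | j | k) h h' <;> simp_all [observedVertices, missingVertices, mem_missing]

theorem disjoint_missingVertices_indicatorVertices (r : Pattern K) :
    Disjoint (missingVertices J r) (indicatorVertices K J) := by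
  rw [Finset.disjoint_left]
  rintro (k | j | k) h h' <;> simp_all [indicatorVertices, missingVertices]

theorem observedVertices_union_missingVertices (r : Pattern K) :
    observedVertices J r ∪ missingVertices J r = (indicatorVertices K J)ᶜ := by
  ext v
  cases v with
  | x k => simp [observedVertices, missingVertices, indicatorVertices, mem_missing]
  | o j => simp [observedVertices, indicatorVertices]
  | r k => simp [observedVertices, missingVertices, indicatorVertices]

theorem missingVertices_complete : missingVertices J (complete K) = ∅ := by
  simp [missingVertices, missing, complete]

theorem dependsOn_observe_withPattern (r : Pattern K) :
    DependsOn (fun c => observe 𝒮 (withPattern 𝒮 r c)) (observedVertices J r : Set (Vtx K J)) := by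
  intro c d h
  funext v
  cases v with
  | x k =>
    change (if r k = true then (Sum.inl (c (.x k)) : 𝒮.X k ⊕ PUnit.{u + 1})
      else Sum.inr PUnit.unit) = if r k = true then Sum.inl (d (.x k)) else Sum.inr PUnit.unit
    by_cases hr : r k = true
    · rw [if_pos hr, if_pos hr]
      exact congrArg Sum.inl (h _ (x_mem_observedVertices.2 hr))
    · rw [if_neg hr, if_neg hr]
      rfl
  | o j => exact h _ (o_mem_observedVertices r j)
  | r k => rfl

/-- Values of the full law with given observed values, the missing ones being taken from `c`. -/
def unobserve (𝒮 : StateSpaces.{u} K J) (c : 𝒮.Full) (y : 𝒮.Obs) : 𝒮.Full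
  | .x k => Sum.elim (fun a : 𝒮.X k => a) (fun _ => c (.x k)) (y (.x k) : 𝒮.X k ⊕ PUnit.{u + 1})
  | .o j => y (.o j)
  | .r k => y (.r k)

theorem measurable_unobserve (c : 𝒮.Full) : Measurable (unobserve 𝒮 c) := by
  refine measurable_pi_iff.2 fun v => ?_
  cases v with
  | x k =>
    let _ := 𝒮.mX k
    have h : Measurable (Sum.elim (fun a : 𝒮.X k => a)
        (fun _ : PUnit.{u + 1} => (c (.x k) : 𝒮.X k))) := measurable_id.sumElim measurable_const
    exact h.comp (measurable_pi_apply (Vtx.x k : Vtx K J))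
  | o j => exact measurable_pi_apply (Vtx.o j : Vtx K J)
  | r k => exact measurable_pi_apply (Vtx.r k : Vtx K J)

theorem unobserve_observe_withPattern (c d : 𝒮.Full) (r : Pattern K) {v : Vtx K J}
    (hv : v ∈ observedVertices J r) :
    unobserve 𝒮 c (observe 𝒮 (withPattern 𝒮 r d)) v = d v := by
  cases v with
  | x k =>
    have hr := x_mem_observedVertices.1 hv
    change Sum.elim (fun a : 𝒮.X k => a) (fun _ => (c (.x k) : 𝒮.X k))
      (if r k = true then (Sum.inl (d (.x k)) : 𝒮.X k ⊕ PUnit.{u + 1})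
        else Sum.inr PUnit.unit) = d (.x k)
    rw [if_pos hr]
    rfl
  | o j => rfl
  | r k => simp [observedVertices] at hv

/-- On each slice along the observed coordinates, both functions have the same integral over every
measurable set, and the slice measure is sigma-finite. -/
theorem IsObservedDensity.ae_eq {ν : Measure 𝒮.Obs} {r : Pattern K} {m m' : 𝒮.Full → ℝ≥0∞}
    (hm : IsObservedDensity 𝒮 ν r m) (hm' : IsObservedDensity 𝒮 ν r m') : m =ᵐ[𝒮.ref] m' := by
  refine ae_of_forall_ae_updateFinset (observedVertices J r)
    (measurableSet_eq_fun hm.measurable hm'.measurable) fun c => ?_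
  refine ae_eq_of_forall_setLIntegral_eq_of_sigmaFinite
    (hm.measurable.comp measurable_updateFinset) (hm'.measurable.comp measurable_updateFinset)
    fun s hs _ => ?_
  -- On records with pattern `r` this map recovers the observed coordinates, so preimages under it
  -- serve as test events; `c` only fills in values off that pattern.
  let e : 𝒮.Obs → ∀ v : observedVertices J r, 𝒮.St v := fun y v => unobserve 𝒮 c y v
  have he : Measurable e := measurable_pi_iff.2 fun v =>
    (measurable_pi_apply (v : Vtx K J)).comp (measurable_unobserve c)
  have key : ∀ m : 𝒮.Full → ℝ≥0∞,
      lmarginal 𝒮.μ (observedVertices J r)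
        (fun c' => (e ⁻¹' s).indicator (fun _ => m c') (observe 𝒮 (withPattern 𝒮 r c'))) c =
      ∫⁻ y in s, m (updateFinset c (observedVertices J r) y)
        ∂(Measure.pi fun v : observedVertices J r => 𝒮.μ v) := by
    intro m
    rw [← lintegral_indicator hs]
    refine lintegral_congr fun y => ?_
    have hy : e (observe 𝒮 (withPattern 𝒮 r (updateFinset c (observedVertices J r) y))) = y :=
      funext fun v => (unobserve_observe_withPattern c _ r v.2).trans
        (updateFinset_apply_of_mem _ _ _ v.2)
    have hiff : observe 𝒮 (withPattern 𝒮 r (updateFinset c (observedVertices J r) y)) ∈ e ⁻¹' s ↔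
        y ∈ s := by rw [Set.mem_preimage, hy]
    by_cases hys : y ∈ s
    · rw [Set.indicator_of_mem hys]
      exact Set.indicator_of_mem (hiff.2 hys) _
    · rw [Set.indicator_of_notMem hys]
      exact Set.indicator_of_notMem (mt hiff.1 hys) _
  exact (key m).symm.trans (((hm.density _ (he hs) c).symm.trans
    (hm'.density _ (he hs) c)).trans (key m'))

variable {f : 𝒮.Full → ℝ≥0∞}

/-- Summing over the indicators first leaves the single term `R = r`. -/
theorem observedLaw_inter_pattern (hf : Measurable f) (r : Pattern K) {B : Set 𝒮.Obs}
    (hB : MeasurableSet B) (c : 𝒮.Full) :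
    observedLaw 𝒮 f (B ∩ {y | ∀ k, (y (.r k) : ULift.{u} Bool).down = r k}) =
      lmarginal 𝒮.μ (indicatorVertices K J)ᶜ
        (fun c => B.indicator (fun _ => jointAt 𝒮 f r c) (observe 𝒮 (withPattern 𝒮 r c))) c := by
  classical
  have hP : MeasurableSet {y : 𝒮.Obs | ∀ k, (y (.r k) : ULift.{u} Bool).down = r k} := by
    rw [Set.ofPred_forall]
    refine MeasurableSet.iInter fun k => ?_
    have h : Measurable fun y : 𝒮.Obs => (y (.r k) : ULift.{u} Bool) :=
      measurable_pi_apply (Vtx.r k : Vtx K J)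
    exact (measurable_down.comp h) (measurableSet_singleton (r k))
  have hBP := measurable_observe 𝒮 (hB.inter hP)
  rw [observedLaw, Measure.map_apply (measurable_observe 𝒮) (hB.inter hP), fullLaw,
    withDensity_apply _ hBP, ← lintegral_indicator hBP,
    lintegral_eq_lmarginal_compl (indicatorVertices K J) (hf.indicator hBP) c]
  congr 1
  funext d
  rw [jointAt, ← lmarginal_indicatorVertices_ite r
    (fun d => B.indicator (fun _ => f d) (observe 𝒮 d)) d]
  congr 1
  funext d
  have hmem : d ∈ observe 𝒮 ⁻¹' (B ∩ {y | ∀ k, (y (.r k) : ULift.{u} Bool).down = r k}) ↔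
      observe 𝒮 d ∈ B ∧ ∀ k, (d (.r k) : ULift.{u} Bool).down = r k := Iff.rfl
  by_cases h1 : ∀ k, (d (.r k) : ULift.{u} Bool).down = r k
  · by_cases h2 : observe 𝒮 d ∈ B
    · rw [Set.indicator_of_mem (hmem.2 ⟨h2, h1⟩), if_pos h1, Set.indicator_of_mem h2]
    · rw [Set.indicator_of_notMem fun h => h2 (hmem.1 h).1, if_pos h1,
        Set.indicator_of_notMem h2]
  · rw [Set.indicator_of_notMem fun h => h1 (hmem.1 h).2, if_neg h1]

/-- The record at pattern `r` ignores `X_M(r)`, so the indicator of an event leaves the integral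
over the missing coordinates. -/
theorem isObservedDensity_lmarginal (hf : Measurable f) (r : Pattern K) :
    IsObservedDensity 𝒮 (observedLaw 𝒮 f) r
      (lmarginal 𝒮.μ (missingVertices J r) (jointAt 𝒮 f r)) where
  measurable := (measurable_jointAt hf r).lmarginal _
  dependsOn := by
    refine (lmarginal_dependsOn_of_dependsOn (dependsOn_comp_withPattern f r)).mono ?_
    rintro v ⟨hv, hv'⟩
    have : v ∈ observedVertices J r ∪ missingVertices J r := by
      rw [observedVertices_union_missingVertices]
      exact Finset.mem_compl.2 hv
    exact (Finset.mem_union.1 this).resolve_right hv'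
  density B hB c := by
    have hind : ∀ F : 𝒮.Full → ℝ≥0∞, (fun c' => B.indicator (fun _ => F c')
        (observe 𝒮 (withPattern 𝒮 r c'))) =
        fun c' => F c' * B.indicator 1 (observe 𝒮 (withPattern 𝒮 r c')) := by
      intro F
      funext c'
      by_cases h : observe 𝒮 (withPattern 𝒮 r c') ∈ B <;> simp [h]
    have hBm : Measurable fun c' => B.indicator (1 : 𝒮.Obs → ℝ≥0∞)
        (observe 𝒮 (withPattern 𝒮 r c')) :=
      (measurable_one.indicator hB).comp
        ((measurable_observe 𝒮).comp (measurable_withPattern r))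
    rw [observedLaw_inter_pattern hf r hB c, hind, hind,
      ← observedVertices_union_missingVertices r, lmarginal_union _
        (fun c' => jointAt 𝒮 f r c' * B.indicator 1 (observe 𝒮 (withPattern 𝒮 r c')))
        ((measurable_jointAt hf r).mul hBm) (disjoint_observedVertices_missingVertices r)]
    congr 1
    funext d
    refine lmarginal_mul_right (measurable_jointAt hf r) (fun x y hxy => ?_) d
    refine congrArg _ (dependsOn_observe_withPattern r fun v hv => hxy v ?_)
    exact Finset.disjoint_left.1 (disjoint_observedVertices_missingVertices r) hv

theorem Positivity.ae_ne_zero (h : Positivity 𝒮 f) : ∀ᵐ c ∂𝒮.ref, f c ≠ 0 := by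
  obtain ⟨ε, hε, h1, -⟩ := h
  filter_upwards [h1] with c hc h0
  rw [h0, ENNReal.zero_div] at hc
  exact hε.ne' (by simpa using hc)

/-- The facts about a positive density that the algorithm at the pattern `r` relies on. -/
theorem ae_lmarginal_missingVertices_jointAt (hf : Measurable f) (hfin : ∫⁻ c, f c ∂𝒮.ref ≠ ∞)
    (hpos : ∀ᵐ c ∂𝒮.ref, f c ≠ 0) (r : Pattern K) :
    ∀ᵐ c ∂𝒮.ref, lmarginal 𝒮.μ (missingVertices J r) (jointAt 𝒮 f r) c ≠ 0 ∧
      lmarginal 𝒮.μ (missingVertices J r) (jointAt 𝒮 f r) c ≠ ∞ := by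
  filter_upwards [ae_lmarginal_ne_zero (missingVertices J r) (measurable_jointAt hf r)
      (ae_withPattern r hpos), ae_lmarginal_jointAt_ne_top hf hfin r
      (disjoint_missingVertices_indicatorVertices r)] with c h h'
  exact ⟨h, h'⟩

theorem measurable_extrapolation (hf : Measurable f) (r : Pattern K) :
    Measurable (extrapolation 𝒮 f r) :=
  (measurable_jointAt hf r).div ((measurable_jointAt hf r).lmarginal _)

theorem lmarginal_extrapolation (hf : Measurable f) (r : Pattern K) {T : Finset (Vtx K J)}
    (hT : T ⊆ missingVertices J r) (c : 𝒮.Full) :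
    lmarginal 𝒮.μ T (extrapolation 𝒮 f r) c = lmarginal 𝒮.μ T (jointAt 𝒮 f r) c *
      (lmarginal 𝒮.μ (missingVertices J r) (jointAt 𝒮 f r) c)⁻¹ :=
  lmarginal_mul_right (h := fun c => (lmarginal 𝒮.μ (missingVertices J r) (jointAt 𝒮 f r) c)⁻¹)
    (measurable_jointAt hf r)
    (fun _ _ hxy => congrArg _ (dependsOn_lmarginal _ _ fun v hv => hxy v fun h => hv (hT h))) c

/-- Conditioning divides by a margin free of `x_i`, which cancels where it is neither `0` nor `∞`.
-/
theorem gibbs_extrapolation (hf : Measurable f) (hfin : ∫⁻ c, f c ∂𝒮.ref ≠ ∞)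
    (hpos : ∀ᵐ c ∂𝒮.ref, f c ≠ 0) {r : Pattern K} {i : Fin K} (hi : i ∈ missing r) :
    gibbs 𝒮 i (extrapolation 𝒮 f r) =ᵐ[𝒮.ref] gibbs 𝒮 i (jointAt 𝒮 f r) := by
  filter_upwards [ae_lmarginal_missingVertices_jointAt hf hfin hpos r] with c hc
  rw [gibbs, gibbs, gibbsDenom, gibbsDenom, lmarginal_extrapolation hf r
    (Finset.singleton_subset_iff.2 (x_mem_missingVertices.2 hi)), extrapolation, div_eq_mul_inv]
  exact ENNReal.mul_div_mul_right _ _ (ENNReal.inv_ne_zero.2 hc.2) (ENNReal.inv_ne_top.2 hc.1)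

/-- Positivity makes both denominators nonzero, so the proviso "wherever both are defined" drops
out. -/
theorem gibbs_jointAt_ae_eq {G : MGraph K J} {H : PatternGraph K} (hH : IsPatternDAG.{u} G H)
    (hM : IsModel G 𝒮 f) {s r : Pattern K} {i : Fin K} (h : (s, i, r) ∈ H.edges) :
    gibbs 𝒮 i (jointAt 𝒮 f r) =ᵐ[𝒮.ref] gibbs 𝒮 i (jointAt 𝒮 f s) := by
  have hne : ∀ p : Pattern K, ∀ᵐ c ∂𝒮.ref, gibbsDenom 𝒮 i (jointAt 𝒮 f p) c ≠ 0 := fun p =>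
    ae_lmarginal_ne_zero _ (measurable_jointAt hM.isDensity.measurable p)
      (ae_withPattern p hM.positivity.ae_ne_zero)
  filter_upwards [hH.gibbs_eq s i r h 𝒮 f hM.isDensity hM.factorizes, hne s, hne r]
    with c h1 h2 h3
  exact (h1 h2 h3).symm

/-- The true densities carry out every step of the algorithm. -/
theorem pmidStep_jointAt {G : MGraph K J} {H : PatternGraph K} (hone : IsOneStepGraph H)
    (hH : IsPatternDAG.{u} G H) (hM : IsModel G 𝒮 f) (r : Pattern K) :
    PMIDStep 𝒮 H (observedLaw 𝒮 f) (jointAt 𝒮 f) (extrapolation 𝒮 f) r := by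
  have hf := hM.isDensity.measurable
  have hfin : ∫⁻ c, f c ∂𝒮.ref ≠ ∞ := by simp [hM.isDensity.lintegral_eq_one]
  have hpos := hM.positivity.ae_ne_zero
  have hL := ae_lmarginal_missingVertices_jointAt hf hfin hpos r
  refine ⟨measurable_jointAt hf r, _, isObservedDensity_lmarginal hf r, ?_, fun _ =>
    ⟨measurable_extrapolation hf r, ?_, fun i hi => ?_, ?_⟩⟩
  · rintro rfl
    rw [missingVertices_complete, lmarginal_empty]
  · filter_upwards [hL] with c hc
    rw [lmarginal_extrapolation hf r subset_rfl, ENNReal.mul_inv_cancel hc.1 hc.2]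
    rfl
  · have hedge := (hone.2 _ i r).2 ⟨mem_missing.1 hi, rfl⟩
    exact ⟨_, hedge, (gibbs_extrapolation hf hfin hpos hi).trans
      (gibbs_jointAt_ae_eq hH hM hedge)⟩
  · filter_upwards [hL] with c hc
    exact (ENNReal.div_mul_cancel hc.1 hc.2).symm

theorem gibbs_congr (i : Fin K) {g g' : 𝒮.Full → ℝ≥0∞} (h : g =ᵐ[𝒮.ref] g') :
    gibbs 𝒮 i g =ᵐ[𝒮.ref] gibbs 𝒮 i g' := by
  filter_upwards [h, lmarginal_ae_congr {.x i} h] with c h1 h2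
  rw [gibbs, gibbs, gibbsDenom, gibbsDenom, h1, h2]

/-- A step of the algorithm computes the true densities if it starts from true densities. -/
theorem PMIDStep.ae_eq {G : MGraph K J} {H : PatternGraph K}
    (hH : IsPatternDAG.{u} G H) (hM : IsModel G 𝒮 f) {joint ext : Pattern K → 𝒮.Full → ℝ≥0∞}
    {r : Pattern K} (hstep : PMIDStep 𝒮 H (observedLaw 𝒮 f) joint ext r)
    (hparents : ∀ s, H.Adj s r → joint s =ᵐ[𝒮.ref] jointAt 𝒮 f s) :
    joint r =ᵐ[𝒮.ref] jointAt 𝒮 f r ∧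
      (r ≠ complete K → ext r =ᵐ[𝒮.ref] extrapolation 𝒮 f r) := by
  have hf := hM.isDensity.measurable
  have hfin : ∫⁻ c, f c ∂𝒮.ref ≠ ∞ := by simp [hM.isDensity.lintegral_eq_one]
  have hpos := hM.positivity.ae_ne_zero
  obtain ⟨-, m, hm, hcomplete, hother⟩ := hstep
  have hm' := hm.ae_eq (isObservedDensity_lmarginal hf r)
  by_cases hr : r = complete K
  · refine ⟨(hcomplete hr).trans (hm'.trans ?_), fun h => absurd hr h⟩
    rw [hr, missingVertices_complete, lmarginal_empty]
  · obtain ⟨hext, hone, hgibbs, hjoint⟩ := hother hr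
    have key : ext r =ᵐ[𝒮.ref] extrapolation 𝒮 f r := by
      -- The comparison density is the true joint density. As the candidate has margin one, the
      -- formula is exactly division by the true margin, that is, the true extrapolation density.
      have h := eq_mul_lmarginal_div_of_gibbs_eq (μ := 𝒮.μ) hext (measurable_jointAt hf r)
        (missingVertices J r) (ae_withPattern r hpos)
        (fun T hT => ae_lmarginal_jointAt_ne_top hf hfin r
          ((disjoint_missingVertices_indicatorVertices r).mono_left hT)) (fun v hv => ?_)
      · filter_upwards [h, hone] with c h1 h2
        rw [h1, h2, extrapolation, div_eq_mul_inv, div_eq_mul_inv, Pi.one_apply, one_mul]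
      · obtain ⟨i, hi, rfl⟩ := Finset.mem_image.1 hv
        obtain ⟨s, hs, hgs⟩ := hgibbs i hi
        exact hgs.trans ((gibbs_congr i (hparents s ⟨i, hs⟩)).trans
          (gibbs_jointAt_ae_eq hH hM hs).symm)
    refine ⟨?_, fun _ => key⟩
    filter_upwards [hjoint, key, hm', ae_lmarginal_missingVertices_jointAt hf hfin hpos r]
      with c h1 h2 h3 h4
    rw [h1, h2, h3]
    exact ENNReal.div_mul_cancel h4.1 h4.2

theorem pmidIdentifies {G : MGraph K J} {H : PatternGraph K} (hone : IsOneStepGraph H)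
    (hH : IsPatternDAG.{u} G H) (hM : IsModel G 𝒮 f) : PMIDIdentifies 𝒮 H f where
  gibbs_eq _ _ _ h := gibbs_jointAt_ae_eq hH hM h
  exists_order := hone.exists_topologicalOrder
  first _ hl := hone.head?_eq hl
  correct r _ := pmidStep_jointAt hone hH hM r
  unique l hl l' hl' joint ext hsteps r hr := by
    -- A parent has fewer missing entries and also lies in the initial segment, so its density is
    -- already known to be the true one.
    induction h : (missing r).card using Nat.strong_induction_on generalizing r with
    | _ n ih =>
      refine (hsteps r hr).ae_eq hH hM fun s hs => ?_
      exact (ih _ (h ▸ hone.card_lt hs) s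
        (hl.mem_prefix_of_adj hl' (hone.1 ▸ Finset.mem_univ s) hr hs) rfl).1

/-- A density is determined by its restrictions to the patterns. -/
theorem ae_eq_of_jointAt {f f' : 𝒮.Full → ℝ≥0∞}
    (h : ∀ r, jointAt 𝒮 f r =ᵐ[𝒮.ref] jointAt 𝒮 f' r) : f =ᵐ[𝒮.ref] f' := by
  filter_upwards [ae_all_iff.2 h] with c hc
  have := hc fun k => (c (.r k) : ULift.{u} Bool).down
  rwa [jointAt, jointAt, withPattern_self] at this

/-- The densities of `f` carry out the algorithm on an observed law that is also that of `f'`, so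
uniqueness for `f'` applies to them. -/
theorem fullLaw_eq_of_observedLaw_eq {G : MGraph K J} {H : PatternGraph K}
    (hone : IsOneStepGraph H) (hH : IsPatternDAG.{u} G H) {f f' : 𝒮.Full → ℝ≥0∞}
    (hM : IsModel G 𝒮 f) (hM' : IsModel G 𝒮 f') (h : observedLaw 𝒮 f = observedLaw 𝒮 f') :
    fullLaw 𝒮 f = fullLaw 𝒮 f' := by
  obtain ⟨l, hl⟩ := hone.exists_topologicalOrder
  refine withDensity_congr_ae (ae_eq_of_jointAt fun r => ?_)
  exact ((pmidIdentifies hone hH hM').unique l hl l (List.prefix_refl l) (jointAt 𝒮 f)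
    (extrapolation 𝒮 f) (fun r _ => h ▸ pmidStep_jointAt hone hH hM r) r
    ((hl.mem_iff r).2 (hone.1 ▸ Finset.mem_univ r))).1

end Identification

end MissingData

theorem corollary1 {K J : ℕ} (G : MGraph K J) (hS1 : G.S1) :
    ∃ H : PatternGraph K,
      pmidConstruction G = some H ∧
      H.verts = Finset.univ ∧
      IsPatternDAG.{u} G H ∧
      PMIDCompatible H ∧
      ∀ 𝒮 : StateSpaces.{u} K J,
        (∀ f : 𝒮.Full → ENNReal, IsModel G 𝒮 f → PMIDIdentifies 𝒮 H f) ∧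
        ∃ Φ : MeasureTheory.Measure 𝒮.Obs → MeasureTheory.Measure 𝒮.Full,
          ∀ f : 𝒮.Full → ENNReal, IsModel G 𝒮 f →
            Φ (observedLaw 𝒮 f) = fullLaw 𝒮 f := by
  classical
  obtain ⟨H, hG, hone⟩ := exists_pmidConstruction hS1
  have hH : IsPatternDAG.{u} G H := hone.isPatternDAG hS1
  refine ⟨H, hG, hone.1, hH, hone.pmidCompatible, fun 𝒮 =>
    ⟨fun f hM => pmidIdentifies hone hH hM,
      -- Any model with observed law `ν` may be chosen, since all of them share one full law; `0` is
      -- a default where no model exists.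
      fun ν => if h : ∃ f, IsModel G 𝒮 f ∧ observedLaw 𝒮 f = ν then fullLaw 𝒮 h.choose else 0,
      fun f hM => ?_⟩⟩
  have h : ∃ f', IsModel G 𝒮 f' ∧ observedLaw 𝒮 f' = observedLaw 𝒮 f := ⟨f, hM, rfl⟩
  exact (dif_pos h).trans
    (fullLaw_eq_of_observedLaw_eq hone hH h.choose_spec.1 hM h.choose_spec.2)
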